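/- **Setting.** Let $d,q\ge 1$, and let $\mathcal I\subset\mathbb R^d$, $\Theta\subset\mathbb R^q$ be compact. Let $(Z_i,\eta_i,\varepsilon_i)$, $i\ge 1$, be i.i.d. copies of $(Z,\eta,\varepsilon)$, where $Z,\eta\in\mathbb R^d$ and $\varepsilon\in\mathbb R$ are mutually independent, $Z$ and $\eta$ have densities $f_Z$ and $f_\eta$, $E\varepsilon=0$ and $E\varepsilon^2<\infty$. Put $X_i=Z_i+\eta_i$, $X=Z+\eta$ and $Y_i=m(X_i)+\varepsilon_i$, where $m:\mathbb R^d\to\mathbb R$ is a given measurable regression function with $Em(X)^2<\infty$. Let $\{m_\theta:\theta\in\Theta\}$ be measurable functions on $\mathbb R^d$ with $E|m_\theta(X)|<\infty$, and define $$H(z)=E[m(X)\mid Z=z]=\int m(z+u)f_\eta(u)\,du,\qquad H_\theta(z)=\int m_\theta(z+u)f_\eta(u)\,du,$$ $$\gamma^2(z)=E[(m(X)-H(Z))^2\mid Z=z]=\int (m(z+u)-H(z))^2f_\eta(u)\,du .$$ Let $G$ be a finite measure with $G(\mathcal I^c)=0$, and put $\rho(\nu_1,\nu_2)=\int(\nu_1-\nu_2)^2\,dG$.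 Let $K,K^*$ be nonnegative, symmetric, square integrable probability densities on $\mathbb R^d$ that vanish outside $[-1,1]^d$, with $K^*$ Lipschitz on $\mathbb R^d$, and write $K_h(x)=K(x/h)/h^d$. Let $h_n>0$ satisfy $h_n\to0$ and $nh_n^{2d}\to\infty$, and let $w_n/(\log n/n)^{1/(d+4)}$ converge to a positive constant. Put $\hat f_{w}(z)=\frac1n\sum_{i=1}^nK^*_{w_n}(z-Z_i)$, $$M_n^*(\theta)=\int\Big[\frac{\sum_{i=1}^nK_{h_n}(z-Z_i)Y_i}{n\hat f_w(z)}-H_\theta(z)\Big]^2dG(z),\qquad M_n(\theta)=\int\Big[\frac{\sum_{i=1}^nK_{h_n}(z-Z_i)(Y_i-H_\theta(Z_i))}{n\hat f_w(z)}\Big]^2dG(z)$$ (with values in $[0,\infty]$, a quotient with zero denominator being read as $0$). Let $\theta_n^*$ and $\hat\theta_n$ be $\Theta$-valued and such that, for all large $n$, almost surely $\theta_n^*$ minimizes $M_n^*$ over $\Theta$ and $\hat\theta_n$ minimizes $M_n$ over $\Theta$. **Assumptions.** (f1) $f_Z$ is bounded below on $\mathcal I$ by a positive constant, and for every $e>0$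 there is $\delta>0$ with $|f_Z(y)-f_Z(z)|<e$ for all $z\in\mathcal I$, $y\in\mathbb R^d$ with $|y-z|<\delta$. (m3) For some $\ell:\mathcal I\to(0,\infty)$ continuous and some $0<\beta\le1$, $|H_{\theta_2}(z)-H_{\theta_1}(z)|\le\|\theta_2-\theta_1\|^\beta\ell(z)$ for all $\theta_1,\theta_2\in\Theta$, $z\in\mathcal I$. Moreover $H\in L_2(G)$, and $\theta\mapsto\rho(H,H_\theta)$ has a unique minimizer $T(H)$ over $\Theta$. **Lemma 3.2.** (a) Suppose that $H$ and $\gamma^2$ are continuous at $G$-almost every $z$, and that either $G$ has a bounded Lebesgue density or $H$ and $\gamma^2$ are bounded on an open set containing $\mathcal I$. Then $\theta_n^*\to T(H)$ in probability. (b) Suppose that $m$ is continuous on $\mathcal I$, that $Em_\theta(X)^2<\infty$ for all $\theta\in\Theta$, that $G(\partial\mathcal I)=0$, and that either $G$ has a bounded Lebesgue density or $m$ and each $m_\theta$ are bounded on $\mathbb R^d$. Then $\hat\theta_n\to T(H)$ in probability. -/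

import Mathlib

open MeasureTheory ProbabilityTheory Filter Topology
open scoped ENNReal NNReal

namespace Berkson

/-- A kernel: a symmetric, square integrable probability density on `ℝ^d` that vanishes outside
the cube `[-1, 1]^d`. -/
structure IsKernel {d : ℕ} (K : EuclideanSpace ℝ (Fin d) → ℝ) : Prop where
  measurable : Measurable K
  nonneg : ∀ u, 0 ≤ K u
  supp : ∀ u, K u ≠ 0 → ∀ j, |u j| ≤ 1
  symm : ∀ u, K (-u) = K u
  integral_eq_one : ∫ u, K u = 1
  sq_integrable : MemLp K 2 volume

/-- The rescaled kernel `K_h(x) = K(x / h) / h^d`. -/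
noncomputable def scaled {d : ℕ} (K : EuclideanSpace ℝ (Fin d) → ℝ) (h : ℝ)
    (x : EuclideanSpace ℝ (Fin d)) : ℝ :=
  K (h⁻¹ • x) / h ^ d

/-- The conditional mean `E[r(X) | Z = z] = ∫ r(z + u) f_η(u) du`, where `X = Z + η` and `η` is
independent of `Z` with density `f_η`. -/
noncomputable def condMean {d : ℕ} (fη : EuclideanSpace ℝ (Fin d) → ℝ)
    (r : EuclideanSpace ℝ (Fin d) → ℝ) (z : EuclideanSpace ℝ (Fin d)) : ℝ :=
  ∫ u, r (z + u) * fη u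

/-- The conditional variance `γ²(z) = E[(r(X) - E[r(X) | Z])² | Z = z]`. -/
noncomputable def condVar {d : ℕ} (fη : EuclideanSpace ℝ (Fin d) → ℝ)
    (r : EuclideanSpace ℝ (Fin d) → ℝ) (z : EuclideanSpace ℝ (Fin d)) : ℝ :=
  ∫ u, (r (z + u) - condMean fη r z) ^ 2 * fη u

/-- The squared distance `ρ(ν₁, ν₂) = ∫ (ν₁ - ν₂)² dG`, with values in `[0, ∞]`. -/
noncomputable def rho {d : ℕ} (G : Measure (EuclideanSpace ℝ (Fin d)))
    (ν₁ ν₂ : EuclideanSpace ℝ (Fin d) → ℝ) : ℝ≥0∞ :=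
  ∫⁻ z, ENNReal.ofReal ((ν₁ z - ν₂ z) ^ 2) ∂G

/-- The kernel density estimator `n⁻¹ ∑_{i<n} K_w(z - Z_i)` at a sample `Z_0, …, Z_{n-1}`. -/
noncomputable def densityEst {d : ℕ} (K : EuclideanSpace ℝ (Fin d) → ℝ) (w : ℝ) (n : ℕ)
    (Zs : ℕ → EuclideanSpace ℝ (Fin d)) (z : EuclideanSpace ℝ (Fin d)) : ℝ :=
  (n : ℝ)⁻¹ * ∑ i ∈ Finset.range n, scaled K w (z - Zs i)

/-- The criterion `M*_n(θ)`, as a function of `Hθ = H_θ`, of the bandwidths `h`, `w` and of the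
observed sample `(Zs i, Ys i)`, `i < n`. -/
noncomputable def critStar {d : ℕ} (G : Measure (EuclideanSpace ℝ (Fin d)))
    (K Ks : EuclideanSpace ℝ (Fin d) → ℝ) (h w : ℝ) (n : ℕ)
    (Zs : ℕ → EuclideanSpace ℝ (Fin d)) (Ys : ℕ → ℝ)
    (Hθ : EuclideanSpace ℝ (Fin d) → ℝ) : ℝ≥0∞ :=
  ∫⁻ z, ENNReal.ofReal
    (((∑ i ∈ Finset.range n, scaled K h (z - Zs i) * Ys i) / (n * densityEst Ks w n Zs z)
      - Hθ z) ^ 2) ∂G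

/-- The criterion `M_n(θ)`, as a function of `Hθ = H_θ`, of the bandwidths `h`, `w` and of the
observed sample `(Zs i, Ys i)`, `i < n`. -/
noncomputable def crit {d : ℕ} (G : Measure (EuclideanSpace ℝ (Fin d)))
    (K Ks : EuclideanSpace ℝ (Fin d) → ℝ) (h w : ℝ) (n : ℕ)
    (Zs : ℕ → EuclideanSpace ℝ (Fin d)) (Ys : ℕ → ℝ)
    (Hθ : EuclideanSpace ℝ (Fin d) → ℝ) : ℝ≥0∞ :=
  ∫⁻ z, ENNReal.ofReal
    (((∑ i ∈ Finset.range n, scaled K h (z - Zs i) * (Ys i - Hθ (Zs i))) /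
      (n * densityEst Ks w n Zs z)) ^ 2) ∂G

/-- `θ` belongs to `Θ` and minimizes the criterion `M` over `Θ`. -/
def IsArgmin {E : Type*} (Θ : Set E) (M : E → ℝ≥0∞) (θ : E) : Prop :=
  θ ∈ Θ ∧ ∀ θ' ∈ Θ, M θ ≤ M θ'

/-- The errors and the design of the Berkson model: the triples `(Z_i, η_i, ε_i)` are i.i.d.,
within a triple the three variables are mutually independent, `Z_i` has density `f_Z`, `η_i` has
density `f_η`, and `ε_i` has mean zero and finite variance. -/
structure IsBerksonDesign {Ω : Type*} [MeasurableSpace Ω] (P : Measure Ω) {d : ℕ}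
    (Z η : ℕ → Ω → EuclideanSpace ℝ (Fin d)) (ε : ℕ → Ω → ℝ)
    (fZ fη : EuclideanSpace ℝ (Fin d) → ℝ) : Prop where
  measurable_Z : ∀ i, Measurable (Z i)
  measurable_η : ∀ i, Measurable (η i)
  measurable_ε : ∀ i, Measurable (ε i)
  measurable_fZ : Measurable fZ
  measurable_fη : Measurable fη
  fZ_nonneg : ∀ z, 0 ≤ fZ z
  fη_nonneg : ∀ u, 0 ≤ fη u
  law_Z : ∀ i, P.map (Z i) = volume.withDensity (fun z => ENNReal.ofReal (fZ z))
  law_η : ∀ i, P.map (η i) = volume.withDensity (fun u => ENNReal.ofReal (fη u))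
  law_ε : ∀ i, P.map (ε i) = P.map (ε 0)
  indep_triple : ∀ i, P.map (fun ω => (Z i ω, η i ω, ε i ω)) =
    (P.map (Z i)).prod ((P.map (η i)).prod (P.map (ε i)))
  indep_sample : iIndepFun (fun i ω => (Z i ω, η i ω, ε i ω)) P
  mean_ε : ∫ ω, ε 0 ω ∂P = 0
  sq_integrable_ε : MemLp (ε 0) 2 P

/-- The design density is uniformly continuous on `S`, as a function on the whole space (points
of `S` are compared with all nearby points), and bounded below by a positive constant on `S`. -/
def DensityCondition {d : ℕ} (fZ : EuclideanSpace ℝ (Fin d) → ℝ)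
    (S : Set (EuclideanSpace ℝ (Fin d))) : Prop :=
  (∀ e > 0, ∃ δ > 0, ∀ z ∈ S, ∀ y, dist y z < δ → |fZ y - fZ z| < e) ∧
    ∃ c > 0, ∀ z ∈ S, c ≤ fZ z

/-- Hölder condition in the parameter: `|H_{θ₂}(z) - H_{θ₁}(z)| ≤ ‖θ₂ - θ₁‖^β ℓ(z)` for
`θ₁, θ₂ ∈ Θ`, `z ∈ S`, with `0 < β ≤ 1` and `ℓ` positive and continuous on `S`. -/
def HolderCondition {d q : ℕ} (Θ : Set (EuclideanSpace ℝ (Fin q)))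
    (S : Set (EuclideanSpace ℝ (Fin d)))
    (H : EuclideanSpace ℝ (Fin q) → EuclideanSpace ℝ (Fin d) → ℝ) : Prop :=
  ∃ (ℓ : EuclideanSpace ℝ (Fin d) → ℝ) (β : ℝ), ContinuousOn ℓ S ∧ (∀ z ∈ S, 0 < ℓ z) ∧
    0 < β ∧ β ≤ 1 ∧
    ∀ θ₁ ∈ Θ, ∀ θ₂ ∈ Θ, ∀ z ∈ S, |H θ₂ z - H θ₁ z| ≤ ‖θ₂ - θ₁‖ ^ β * ℓ z

/-- `G` has a bounded density with respect to Lebesgue measure. -/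
def HasBoundedDensity {d : ℕ} (G : Measure (EuclideanSpace ℝ (Fin d))) : Prop :=
  ∃ (g : EuclideanSpace ℝ (Fin d) → ℝ≥0) (C : ℝ≥0), Measurable g ∧ (∀ z, g z ≤ C) ∧
    G = volume.withDensity (fun z => (g z : ℝ≥0∞))

end Berkson

/-!
Both estimators minimize a squared `L²(G)` norm over `Θ`, and both proofs compare that norm with the
distance `‖H - H_θ‖` in `L²(G)`, whose unique minimizer is `T(H)`.

*Kernel regression.* For an i.i.d. sample `(Z_i, V_i)` with regression function `r`, the estimator
`∑ K_h(z - Z_i) V_i / (n f̂_w(z))` converges to `r` in `L²(G)`, in probability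
(`IsRegressionSample.tendsto_measure_eLpNorm`). The denominator is uniformly consistent on `I`, by
Bernstein's inequality on a fine grid and the Lipschitz continuity of `K*`
(`tendsto_measure_densityEst`), so that only the numerator remains, whose integrated mean squared
error is variance plus squared bias. The variance is of order `1 / (n h ^ d)`. The bias at `z` is
controlled by the mean squared oscillation of `f_Z r` around `z` under `K_h(z - ·)`; its integral
vanishes either by dominated convergence at the continuity points of `r`, or, if `G` has a bounded
density, by approximation in `L²` with continuous functions.

*Argmin.* For (a) the result applies to `V = Y`: the criterion is the norm of the estimator minus
`H_θ`, hence uniformly close to `‖H - H_θ‖`. For (b) it applies to `V = Y - H_θ(Z)`, for which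
`r = H - H_θ`, at each fixed `θ`. Uniformity in `θ` comes from a finite net in `Θ` and the Hölder
condition, but that condition says nothing about design points outside `I`, so it is available only
at points `z` whose distance to the complement of `I` exceeds the bandwidth. This suffices:
a lower bound of the criterion away from `T(H)` may be proved after discarding a set of small
`G`-measure, here a neighbourhood of the boundary of `I`, and at `T(H)` itself no uniformity is
needed (`tendstoInMeasure_argmin`). When the functions `m`, `m_θ` are bounded, `H` and `H_θ` are
continuous, as convolutions of a bounded and an integrable function (`continuous_condMean`).
-/

namespace Berkson

variable {d : ℕ}

local notation "𝔼" => EuclideanSpace ℝ (Fin d)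

/-! ### Rescaled kernels -/

theorem IsKernel.norm_le {K : 𝔼 → ℝ} (hK : IsKernel K) {u : 𝔼} (hu : K u ≠ 0) :
    ‖u‖ ≤ √d := by
  rw [EuclideanSpace.norm_eq]
  refine Real.sqrt_le_sqrt ?_
  calc ∑ i, ‖u i‖ ^ 2 ≤ ∑ _i : Fin d, (1 : ℝ) := by
        refine Finset.sum_le_sum fun i _ => ?_
        have := hK.supp u hu i
        rw [← Real.norm_eq_abs] at this
        exact pow_le_one₀ (norm_nonneg _) this
    _ = d := by simp

theorem IsKernel.scaled_nonneg {K : 𝔼 → ℝ} (hK : IsKernel K) {h : ℝ} (hh : 0 < h) (x : 𝔼) :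
    0 ≤ scaled K h x :=
  div_nonneg (hK.nonneg _) (by positivity)

theorem IsKernel.norm_le_of_scaled_ne_zero {K : 𝔼 → ℝ} (hK : IsKernel K) {h : ℝ} (hh : 0 < h)
    {x : 𝔼} (hx : scaled K h x ≠ 0) : ‖x‖ ≤ √d * h := by
  have h0 : K (h⁻¹ • x) ≠ 0 := fun h0 => hx (by simp [scaled, h0])
  have := hK.norm_le h0
  rw [norm_smul, norm_inv, Real.norm_of_nonneg hh.le, inv_mul_le_iff₀ hh] at this
  linarith

theorem IsKernel.measurable_scaled {K : 𝔼 → ℝ} (hK : IsKernel K) (h : ℝ) :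
    Measurable (scaled K h) := by
  have := hK.measurable
  unfold scaled
  fun_prop

theorem IsKernel.scaled_sub_comm {K : 𝔼 → ℝ} (hK : IsKernel K) (h : ℝ) (x y : 𝔼) :
    scaled K h (x - y) = scaled K h (y - x) := by
  unfold scaled
  rw [← hK.symm, ← smul_neg, neg_sub]

/-- Change of variables `u = (z - y) / h` in a Lebesgue integral. -/
theorem lintegral_comp_inv_smul_sub {h : ℝ} (hh : 0 < h) (z : 𝔼) {F : 𝔼 → ℝ≥0∞}
    (hF : Measurable F) :
    ∫⁻ y, F (h⁻¹ • (z - y)) = ENNReal.ofReal (h ^ d) * ∫⁻ u, F u := by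
  have h1 : ∫⁻ y, F (h⁻¹ • (z - y)) = ∫⁻ y, F (h⁻¹ • y) :=
    lintegral_sub_left_eq_self (fun y => F (h⁻¹ • y)) z
  have h2 : ∫⁻ y, F (h⁻¹ • y) = ∫⁻ u, F u ∂(Measure.map (h⁻¹ • ·) volume) :=
    (lintegral_map hF (measurable_const_smul _)).symm
  rw [h1, h2, Measure.map_addHaar_smul _ (inv_ne_zero hh.ne'), lintegral_smul_measure]
  simp [abs_of_pos hh]

theorem IsKernel.lintegral_eq_one {K : 𝔼 → ℝ} (hK : IsKernel K) :
    ∫⁻ u, ENNReal.ofReal (K u) = 1 := by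
  have hint : Integrable K := by
    by_contra hn
    have := hK.integral_eq_one
    rw [integral_undef hn] at this
    exact zero_ne_one this
  rw [← ofReal_integral_eq_lintegral_ofReal hint (ae_of_all _ hK.nonneg), hK.integral_eq_one,
    ENNReal.ofReal_one]

theorem IsKernel.lintegral_scaled {K : 𝔼 → ℝ} (hK : IsKernel K) {h : ℝ} (hh : 0 < h) (z : 𝔼) :
    ∫⁻ y, ENNReal.ofReal (scaled K h (z - y)) = 1 := by
  have hm := hK.measurable
  have hd : 0 < h ^ d := by positivity
  have := lintegral_comp_inv_smul_sub (d := d) hh z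
    (F := fun u => ENNReal.ofReal (K u / h ^ d)) (by fun_prop)
  unfold scaled
  rw [this]
  simp_rw [ENNReal.ofReal_div_of_pos hd, div_eq_mul_inv]
  rw [lintegral_mul_const _ (by fun_prop), hK.lintegral_eq_one, one_mul,
    ENNReal.mul_inv_cancel (by simpa using hd) ENNReal.ofReal_ne_top]

/-- The squared `L²` norm of a kernel, as an extended nonnegative real. -/
noncomputable def kernelEnergy (K : 𝔼 → ℝ) : ℝ≥0∞ := ∫⁻ u, ENNReal.ofReal (K u ^ 2)

theorem lintegral_ofReal_sq_eq {α : Type*} [MeasurableSpace α] {μ : Measure α} (f : α → ℝ) :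
    ∫⁻ x, ENNReal.ofReal (f x ^ 2) ∂μ = eLpNorm f 2 μ ^ 2 := by
  have h := eLpNorm_nnreal_pow_eq_lintegral (μ := μ) (f := f) (p := 2) two_ne_zero
  rw [NNReal.coe_ofNat] at h
  simp only [ENNReal.coe_ofNat, ENNReal.rpow_ofNat] at h
  refine Eq.trans (lintegral_congr fun x => ?_) h.symm
  rw [← sq_abs, ENNReal.ofReal_pow (abs_nonneg _), ← Real.norm_eq_abs, ofReal_norm]

theorem IsKernel.kernelEnergy_lt_top {K : 𝔼 → ℝ} (hK : IsKernel K) : kernelEnergy K < ∞ := by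
  unfold kernelEnergy
  rw [lintegral_ofReal_sq_eq]
  exact ENNReal.pow_lt_top hK.sq_integrable.2

theorem IsKernel.lintegral_scaled_sq {K : 𝔼 → ℝ} (hK : IsKernel K) {h : ℝ} (hh : 0 < h) (z : 𝔼) :
    ∫⁻ y, ENNReal.ofReal (scaled K h (z - y) ^ 2) =
      kernelEnergy K / ENNReal.ofReal (h ^ d) := by
  have hm := hK.measurable
  have hd : 0 < h ^ d := by positivity
  have := lintegral_comp_inv_smul_sub (d := d) hh z
    (F := fun u => ENNReal.ofReal ((K u / h ^ d) ^ 2)) (by fun_prop)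
  unfold scaled
  rw [this]
  have h0 : ENNReal.ofReal (h ^ d) ≠ 0 := by simpa using hd
  simp_rw [div_pow, ENNReal.ofReal_div_of_pos (pow_pos hd 2), div_eq_mul_inv]
  rw [lintegral_mul_const _ (by fun_prop), kernelEnergy, ENNReal.ofReal_pow hd.le, mul_left_comm,
    sq, ENNReal.mul_inv (Or.inl h0) (Or.inl ENNReal.ofReal_ne_top), ← mul_assoc (ENNReal.ofReal _),
    ENNReal.mul_inv_cancel h0 ENNReal.ofReal_ne_top, one_mul]

/-- The probability measure with density `K_h(z - ·)`. -/
noncomputable def kernelMeasure (K : 𝔼 → ℝ) (h : ℝ) (z : 𝔼) : Measure 𝔼 :=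
  volume.withDensity fun y => ENNReal.ofReal (scaled K h (z - y))

theorem IsKernel.isProbabilityMeasure_kernelMeasure {K : 𝔼 → ℝ} (hK : IsKernel K) {h : ℝ}
    (hh : 0 < h) (z : 𝔼) : IsProbabilityMeasure (kernelMeasure K h z) :=
  ⟨by rw [kernelMeasure, withDensity_apply _ MeasurableSet.univ, Measure.restrict_univ,
    hK.lintegral_scaled hh]⟩

theorem IsKernel.integral_kernelMeasure {K : 𝔼 → ℝ} (hK : IsKernel K) {h : ℝ} (hh : 0 < h) (z : 𝔼)
    (f : 𝔼 → ℝ) : ∫ y, f y ∂kernelMeasure K h z = ∫ y, scaled K h (z - y) * f y := by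
  have := hK.measurable_scaled h
  rw [kernelMeasure, integral_withDensity_eq_integral_toReal_smul (by fun_prop)
    (ae_of_all _ fun _ => ENNReal.ofReal_lt_top)]
  simp_rw [ENNReal.toReal_ofReal (hK.scaled_nonneg hh _), smul_eq_mul]

theorem IsKernel.ae_kernelMeasure {K : 𝔼 → ℝ} (hK : IsKernel K) {h : ℝ} (hh : 0 < h) (z : 𝔼) :
    ∀ᵐ y ∂kernelMeasure K h z, ‖z - y‖ ≤ √d * h := by
  have := hK.measurable_scaled h
  rw [kernelMeasure, ae_withDensity_iff (by fun_prop)]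
  refine ae_of_all _ fun y hy => hK.norm_le_of_scaled_ne_zero hh fun h0 => hy ?_
  rw [h0, ENNReal.ofReal_zero]

/-- Jensen's inequality for the square. If `f` is not integrable, the left side is `0`. -/
theorem ofReal_sq_integral_le {α : Type*} [MeasurableSpace α] (ν : Measure α)
    [IsProbabilityMeasure ν] (f : α → ℝ) :
    ENNReal.ofReal ((∫ x, f x ∂ν) ^ 2) ≤ ∫⁻ x, ENNReal.ofReal (f x ^ 2) ∂ν := by
  by_cases hf : AEStronglyMeasurable f ν
  swap
  · rw [integral_undef fun h => hf h.1]; simp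
  rw [lintegral_ofReal_sq_eq, ← sq_abs, ENNReal.ofReal_pow (abs_nonneg _), ← Real.norm_eq_abs,
    ofReal_norm]
  gcongr
  calc ‖∫ x, f x ∂ν‖ₑ ≤ ∫⁻ x, ‖f x‖ₑ ∂ν := enorm_integral_le_lintegral_enorm f
    _ = eLpNorm f 1 ν := eLpNorm_one_eq_lintegral_enorm.symm
    _ ≤ eLpNorm f 2 ν := eLpNorm_le_eLpNorm_of_exponent_le (by norm_num) hf

/-! ### Uniform consistency of the density estimator -/

section Bernstein

variable {Ω : Type*} [MeasurableSpace Ω] {P : Measure Ω} [IsProbabilityMeasure P]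

/-- The bound comes from `exp x ≤ 1 + x + x ^ 2`, valid for `|x| ≤ 1`. -/
theorem mgf_sub_mean_le {X : Ω → ℝ} (hX : Measurable X) {M v s : ℝ} (h0 : ∀ ω, 0 ≤ X ω)
    (hM : ∀ ω, X ω ≤ M) (hv : ∫ ω, X ω ^ 2 ∂P ≤ v) (hs : |s| * M ≤ 1) :
    mgf (fun ω => X ω - ∫ ω, X ω ∂P) P s ≤ Real.exp (s ^ 2 * v) := by
  have hint : Integrable X P := Integrable.of_bound hX.aestronglyMeasurable M
    (ae_of_all _ fun ω => by rw [Real.norm_of_nonneg (h0 ω)]; exact hM ω)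
  have hint2 : Integrable (fun ω => X ω ^ 2) P :=
    Integrable.of_bound (hX.pow_const 2).aestronglyMeasurable (M ^ 2)
    (ae_of_all _ fun ω => by
      rw [Real.norm_of_nonneg (sq_nonneg _)]; exact pow_le_pow_left₀ (h0 ω) (hM ω) 2)
  have hsX : ∀ ω, |s * X ω| ≤ 1 := fun ω => by
    rw [abs_mul, abs_of_nonneg (h0 ω)]
    exact (mul_le_mul_of_nonneg_left (hM ω) (abs_nonneg s)).trans hs
  have hexp : ∀ ω, Real.exp (s * X ω) ≤ 1 + s * X ω + s ^ 2 * X ω ^ 2 := fun ω => by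
    have := (abs_le.1 (Real.abs_exp_sub_one_sub_id_le (hsX ω))).2
    rw [mul_pow] at this
    linarith
  have hexpint : Integrable (fun ω => Real.exp (s * X ω)) P :=
    Integrable.of_bound (by fun_prop) (Real.exp 1) (ae_of_all _ fun ω => by
      rw [Real.norm_of_nonneg (Real.exp_nonneg _)]
      exact Real.exp_le_exp.2 ((le_abs_self _).trans (hsX ω)))
  have hlin : Integrable (fun ω => 1 + s * X ω) P := (integrable_const 1).add (hint.const_mul s)
  set μ := ∫ ω, X ω ∂P
  have h1 : ∫ ω, Real.exp (s * X ω) ∂P ≤ 1 + s * μ + s ^ 2 * v := by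
    calc ∫ ω, Real.exp (s * X ω) ∂P ≤ ∫ ω, (1 + s * X ω + s ^ 2 * X ω ^ 2) ∂P :=
          integral_mono hexpint (hlin.add (hint2.const_mul _)) hexp
      _ = 1 + s * μ + s ^ 2 * ∫ ω, X ω ^ 2 ∂P := by
          rw [integral_add hlin (hint2.const_mul _),
            integral_add (integrable_const 1) (hint.const_mul s), integral_const_mul,
            integral_const_mul]
          simp [μ]
      _ ≤ _ := by gcongr
  have h2 : mgf (fun ω => X ω - μ) P s = Real.exp (-(s * μ)) * ∫ ω, Real.exp (s * X ω) ∂P := by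
    rw [mgf, ← integral_const_mul]
    congr 1 with ω
    rw [← Real.exp_add]; ring_nf
  rw [h2]
  calc Real.exp (-(s * μ)) * ∫ ω, Real.exp (s * X ω) ∂P
      ≤ Real.exp (-(s * μ)) * Real.exp (s * μ + s ^ 2 * v) := by
        gcongr
        refine h1.trans ?_
        have := Real.add_one_le_exp (s * μ + s ^ 2 * v)
        linarith
    _ = Real.exp (s ^ 2 * v) := by rw [← Real.exp_add]; ring_nf

/-- Bernstein's inequality for bounded nonnegative variables, with the free parameter `t` of the
exponential Markov inequality kept. -/
theorem measureReal_le_abs_sum_sub_mean {X : ℕ → Ω → ℝ} (hX : ∀ i, Measurable (X i))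
    (hind : iIndepFun X P) {M v t e : ℝ} (h0 : ∀ i ω, 0 ≤ X i ω) (hM : ∀ i ω, X i ω ≤ M)
    (hv : ∀ i, ∫ ω, X i ω ^ 2 ∂P ≤ v) (ht : 0 ≤ t) (htM : t * M ≤ 1) (n : ℕ) :
    P.real {ω | n * e ≤ |∑ i ∈ Finset.range n, (X i ω - ∫ ω, X i ω ∂P)|} ≤
      2 * Real.exp (-(t * (n * e)) + n * (t ^ 2 * v)) := by
  set W : ℕ → Ω → ℝ := fun i ω => X i ω - ∫ ω, X i ω ∂P
  have hW : ∀ i, Measurable (W i) := fun i => (hX i).sub_const _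
  have hWind : iIndepFun W P := hind.comp (fun i x => x - ∫ ω, X i ω ∂P) (fun i => by fun_prop)
  have hmgf : ∀ s, |s| = t →
      mgf (∑ i ∈ Finset.range n, W i) P s ≤ Real.exp (n * (t ^ 2 * v)) := by
    intro s hs
    rw [hWind.mgf_sum hW]
    calc ∏ i ∈ Finset.range n, mgf (W i) P s
        ≤ ∏ _i ∈ Finset.range n, Real.exp (s ^ 2 * v) :=
          Finset.prod_le_prod (fun i _ => mgf_nonneg)
            fun i _ => mgf_sub_mean_le (hX i) (h0 i) (hM i) (hv i) (by rwa [hs])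
      _ = Real.exp (n * (t ^ 2 * v)) := by
          rw [Finset.prod_const, Finset.card_range, ← Real.exp_nat_mul, ← hs, sq_abs]
  have hWb : ∀ i, ∃ C, ∀ ω, |W i ω| ≤ C := fun i =>
    ⟨M + |∫ ω, X i ω ∂P|, fun ω => (abs_sub _ _).trans (by
      rw [abs_of_nonneg (h0 i ω)]; gcongr; exact hM i ω)⟩
  choose C hC using hWb
  have hint : ∀ s : ℝ, Integrable (fun ω => Real.exp (s * (∑ i ∈ Finset.range n, W i) ω)) P := by
    intro s
    refine Integrable.of_bound (Measurable.aestronglyMeasurable ?_)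
      (Real.exp (|s| * ∑ i ∈ Finset.range n, C i)) (ae_of_all _ fun ω => ?_)
    · simp only [Finset.sum_apply]
      fun_prop
    · rw [Real.norm_of_nonneg (Real.exp_nonneg _), Real.exp_le_exp]
      refine (le_abs_self _).trans ?_
      rw [abs_mul, Finset.sum_apply]
      gcongr
      exact (Finset.abs_sum_le_sum_abs _ _).trans (Finset.sum_le_sum fun i _ => hC i ω)
  have hup := measure_ge_le_exp_mul_mgf (μ := P) (X := ∑ i ∈ Finset.range n, W i) (n * e) ht
    (hint t)
  have hlo := measure_le_le_exp_mul_mgf (μ := P) (X := ∑ i ∈ Finset.range n, W i) (-(n * e))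
    (neg_nonpos.2 ht) (hint (-t))
  have e1 : Real.exp (-t * (n * e)) * mgf (∑ i ∈ Finset.range n, W i) P t ≤
      Real.exp (-(t * (n * e)) + n * (t ^ 2 * v)) := by
    rw [Real.exp_add, neg_mul]
    gcongr
    exact hmgf t (abs_of_nonneg ht)
  have e2 : Real.exp (- -t * -(n * e)) * mgf (∑ i ∈ Finset.range n, W i) P (-t) ≤
      Real.exp (-(t * (n * e)) + n * (t ^ 2 * v)) := by
    rw [Real.exp_add, neg_neg, mul_neg]
    gcongr
    exact hmgf (-t) (by rw [abs_neg, abs_of_nonneg ht])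
  calc P.real {ω | n * e ≤ |∑ i ∈ Finset.range n, (X i ω - ∫ ω, X i ω ∂P)|}
      ≤ P.real ({ω | n * e ≤ (∑ i ∈ Finset.range n, W i) ω} ∪
          {ω | (∑ i ∈ Finset.range n, W i) ω ≤ -(n * e)}) := by
        refine measureReal_mono fun ω hω => ?_
        simp only [Set.mem_union, Set.mem_ofPred_eq, Finset.sum_apply] at hω ⊢
        rcases le_abs'.1 hω with h | h
        · exact Or.inr h
        · exact Or.inl h
    _ ≤ _ := (measureReal_union_le _ _).trans (by linarith)

end Bernstein

/-- A bounded set is covered by at most `(2R/ρ + 3)^d` balls of radius `√d ρ`. -/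
theorem exists_finset_cover {S : Set 𝔼} {R : ℝ} (hR : 0 ≤ R) (hS : ∀ z ∈ S, ‖z‖ ≤ R)
    {ρ : ℝ} (hρ : 0 < ρ) :
    ∃ T : Finset 𝔼, (T.card : ℝ) ≤ (2 * (R / ρ) + 3) ^ d ∧
      ∀ z ∈ S, ∃ p ∈ T, dist z p ≤ √d * ρ := by
  classical
  set M : ℕ := ⌈R / ρ⌉₊
  let g : (Fin d → ℤ) → 𝔼 := fun k => WithLp.toLp 2 fun j => ρ * k j
  refine ⟨(Fintype.piFinset fun _ => Finset.Icc (-M : ℤ) M).image g, ?_, fun z hz => ?_⟩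
  · have hM : (M : ℝ) ≤ R / ρ + 1 := (Nat.ceil_lt_add_one (by positivity)).le
    calc (((Fintype.piFinset fun _ : Fin d => Finset.Icc (-M : ℤ) M).image g).card : ℝ)
        ≤ ((Fintype.piFinset fun _ : Fin d => Finset.Icc (-M : ℤ) M).card : ℝ) := by
          exact_mod_cast Finset.card_image_le
      _ = (2 * M + 1 : ℝ) ^ d := by
          rw [Fintype.card_piFinset]
          simp only [Int.card_Icc, Finset.prod_const, Finset.card_univ, Fintype.card_fin]
          rw [show ((M : ℤ) + 1 - -(M : ℤ)).toNat = 2 * M + 1 by omega]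
          push_cast
          rfl
      _ ≤ _ := pow_le_pow_left₀ (by positivity) (by linarith) d
  · refine ⟨g fun j => ⌊z j / ρ⌋,
      Finset.mem_image_of_mem _ (Fintype.mem_piFinset.2 fun j => ?_), ?_⟩
    · have hzj : |z j| ≤ R := (EuclideanSpace.norm_eq z ▸ Real.abs_le_sqrt (by
        have := Finset.single_le_sum (f := fun i => ‖z i‖ ^ 2) (fun i _ => by positivity)
          (Finset.mem_univ j)
        simpa using this)).trans (hS z hz)
      have h1 : z j / ρ ≤ M := (div_le_div_of_nonneg_right (abs_le.1 hzj).2 hρ.le).trans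
        (Nat.le_ceil _)
      have h2 : -(M : ℝ) ≤ z j / ρ := by
        rw [neg_le, ← neg_div]
        exact (div_le_div_of_nonneg_right (neg_le.1 (abs_le.1 hzj).1) hρ.le).trans (Nat.le_ceil _)
      rw [Finset.mem_Icc]
      refine ⟨Int.le_floor.2 (by push_cast; exact h2), ?_⟩
      exact Int.cast_le.1 (((Int.floor_le (z j / ρ)).trans h1).trans_eq (Int.cast_natCast M).symm)
    · rw [EuclideanSpace.dist_eq]
      calc √(∑ j, dist (z j) (g (fun j => ⌊z j / ρ⌋) j) ^ 2) ≤ √(∑ _j : Fin d, ρ ^ 2) := by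
            refine Real.sqrt_le_sqrt (Finset.sum_le_sum fun j _ => ?_)
            refine pow_le_pow_left₀ dist_nonneg ?_ 2
            have h1 := Int.floor_le (z j / ρ)
            have h2 := (Int.lt_floor_add_one (z j / ρ)).le
            rw [le_div_iff₀ hρ] at h1
            rw [div_le_iff₀ hρ] at h2
            rw [Real.dist_eq, abs_le]
            simp only [g]
            constructor <;> nlinarith
        _ = √d * ρ := by
            simp [Real.sqrt_sq hρ.le]

/-- A density that is uniformly continuous on a compact set is bounded near that set. -/
theorem DensityCondition.exists_bound {fZ : 𝔼 → ℝ} {I : Set 𝔼} (hI : IsCompact I)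
    (f1 : DensityCondition fZ I) :
    ∃ B > 0, ∃ δ > 0, ∀ z ∈ I, ∀ y, dist y z < δ → fZ y ≤ B := by
  have hcont : ContinuousOn fZ I := fun z hz => by
    refine ContinuousAt.continuousWithinAt (Metric.continuousAt_iff.2 fun e he => ?_)
    obtain ⟨δ, hδ, h⟩ := f1.1 e he
    exact ⟨δ, hδ, fun y hy => h z hz y hy⟩
  obtain ⟨C, hC⟩ := hI.exists_bound_of_continuousOn hcont
  obtain ⟨δ, hδ, h⟩ := f1.1 1 one_pos
  refine ⟨|C| + 1, by positivity, δ, hδ, fun z hz y hy => ?_⟩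
  have h1 := (abs_lt.1 (h z hz y hy)).2
  have h2 := (le_abs_self _).trans ((hC z hz).trans (le_abs_self C))
  linarith

theorem IsKernel.exists_bound_of_lipschitzWith {K : 𝔼 → ℝ} (hK : IsKernel K) {L : ℝ≥0}
    (hL : LipschitzWith L K) : ∃ κ > 0, ∀ u, K u ≤ κ := by
  obtain ⟨C, hC⟩ := (isCompact_closedBall (0 : 𝔼) √d).exists_bound_of_continuousOn
    hL.continuous.continuousOn
  refine ⟨|C| + 1, by positivity, fun u => ?_⟩
  by_cases hu : K u = 0
  · rw [hu]; positivity
  · have := (le_abs_self _).trans ((hC u (by simpa using hK.norm_le hu)).trans (le_abs_self C))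
    linarith

theorem abs_scaled_sub_le {K : 𝔼 → ℝ} {L : ℝ≥0} (hL : LipschitzWith L K) {h : ℝ} (hh : 0 < h)
    (x y : 𝔼) : |scaled K h x - scaled K h y| ≤ L / h ^ (d + 1) * dist x y := by
  have h1 := hL.dist_le_mul (h⁻¹ • x) (h⁻¹ • y)
  rw [dist_smul₀, norm_inv, Real.norm_of_nonneg hh.le, Real.dist_eq] at h1
  unfold scaled
  rw [← sub_div, abs_div, abs_of_pos (pow_pos hh d), div_le_iff₀ (pow_pos hh d)]
  refine h1.trans_eq ?_
  field_simp
  ring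

/-- The consistency proof uses the bandwidth only through `w → 0` and `n w ^ (d + 1) ≥ 1`. The
latter holds because `n w ^ (d + 4)` is of order `log n`. -/
theorem eventually_bandwidth {w : ℕ → ℝ} {c : ℝ} (hc : 0 < c) (hw : Tendsto
      (fun n : ℕ => w n / (Real.log n / n) ^ ((1 : ℝ) / ((d : ℝ) + 4))) atTop (𝓝 c)) :
    (∀ᶠ n in atTop, 0 < w n) ∧ Tendsto w atTop (𝓝 0) ∧
      ∀ᶠ n : ℕ in atTop, 1 ≤ n * w n ^ (d + 1) := by
  set b : ℕ → ℝ := fun n => (Real.log n / n) ^ ((1 : ℝ) / ((d : ℝ) + 4))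
  have hlog : Tendsto (fun n : ℕ => Real.log n / n) atTop (𝓝 0) :=
    (Real.isLittleO_log_id_atTop.tendsto_div_nhds_zero).comp tendsto_natCast_atTop_atTop
  have hd4 : (0 : ℝ) < 1 / ((d : ℝ) + 4) := by positivity
  have hb : Tendsto b atTop (𝓝 0) := by
    have := hlog.rpow_const (p := (1 : ℝ) / ((d : ℝ) + 4)) (Or.inr hd4.le)
    rwa [Real.zero_rpow hd4.ne'] at this
  have hbpos : ∀ᶠ n in atTop, 0 < b n := by
    filter_upwards [eventually_ge_atTop 2] with n hn
    have : (1 : ℝ) < n := by exact_mod_cast hn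
    exact Real.rpow_pos_of_pos (div_pos (Real.log_pos this) (by linarith)) _
  have hpos : ∀ᶠ n in atTop, 0 < w n := by
    filter_upwards [hbpos, hw.eventually (lt_mem_nhds hc)] with n h1 h2
    exact (div_pos_iff_of_pos_right h1).1 h2
  have hw0 : Tendsto w atTop (𝓝 0) := by
    have := hw.mul hb
    rw [mul_zero] at this
    refine this.congr' ?_
    filter_upwards [hbpos] with n hn
    exact div_mul_cancel₀ _ hn.ne'
  refine ⟨hpos, hw0, ?_⟩
  have hlogtop : Tendsto (fun n : ℕ => (w n / b n) ^ (d + 4) * Real.log n) atTop atTop :=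
    (hw.pow (d + 4)).pos_mul_atTop (by positivity)
      (Real.tendsto_log_atTop.comp tendsto_natCast_atTop_atTop)
  filter_upwards [hpos, hw0.eventually (gt_mem_nhds one_pos), hlogtop.eventually_ge_atTop 1, hbpos,
    eventually_ge_atTop 2] with n h1 h2 h3 h4 hn
  have hn1 : (1 : ℝ) < n := by exact_mod_cast hn
  have hbp : b n ^ (d + 4) = Real.log n / n := by
    rw [← Real.rpow_natCast, ← Real.rpow_mul (div_pos (Real.log_pos hn1) (by linarith)).le]
    push_cast
    rw [one_div_mul_cancel (by positivity), Real.rpow_one]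
  have hl := Real.log_pos hn1
  calc (1 : ℝ) ≤ (w n / b n) ^ (d + 4) * Real.log n := h3
    _ = n * w n ^ (d + 4) := by
        rw [div_pow, hbp]; field_simp
    _ ≤ n * w n ^ (d + 1) := by
        gcongr ?_ * ?_
        exact pow_le_pow_of_le_one h1.le h2.le (by omega)

section DensityEstimator

variable {Ω : Type*} [MeasurableSpace Ω] {P : Measure Ω}

theorem integral_comp_of_law {ζ : Ω → 𝔼} (hζ : Measurable ζ) {f : 𝔼 → ℝ} (hf : Measurable f)
    (hf0 : ∀ z, 0 ≤ f z) (hlaw : P.map ζ = volume.withDensity fun z => ENNReal.ofReal (f z))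
    {F : 𝔼 → ℝ} (hF : Measurable F) : ∫ ω, F (ζ ω) ∂P = ∫ y, F y * f y := by
  rw [← integral_map hζ.aemeasurable hF.aestronglyMeasurable, hlaw,
    integral_withDensity_eq_integral_toReal_smul (by fun_prop)
      (ae_of_all _ fun _ => ENNReal.ofReal_lt_top)]
  simp_rw [ENNReal.toReal_ofReal (hf0 _), smul_eq_mul, mul_comm]

theorem lintegral_comp_of_law {ζ : Ω → 𝔼} (hζ : Measurable ζ) {f : 𝔼 → ℝ} (hf : Measurable f)
    (hlaw : P.map ζ = volume.withDensity fun z => ENNReal.ofReal (f z))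
    {F : 𝔼 → ℝ≥0∞} (hF : Measurable F) :
    ∫⁻ ω, F (ζ ω) ∂P = ∫⁻ y, ENNReal.ofReal (f y) * F y := by
  rw [← lintegral_map hF hζ, hlaw, lintegral_withDensity_eq_lintegral_mul _ (by fun_prop) hF]
  rfl

/-- Averages against a kernel concentrated near `z` reproduce the value at `z`. -/
theorem IsKernel.abs_integral_kernelMeasure_sub_le {K : 𝔼 → ℝ} (hK : IsKernel K) {h : ℝ}
    (hh : 0 < h) {f : 𝔼 → ℝ} (hf : Measurable f) (p : 𝔼) {a e : ℝ}
    (hfa : ∀ y, ‖p - y‖ ≤ √d * h → |f y - a| ≤ e) :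
    |∫ y, f y ∂kernelMeasure K h p - a| ≤ e := by
  have := hK.isProbabilityMeasure_kernelMeasure hh p
  have hae : ∀ᵐ y ∂kernelMeasure K h p, ‖f y - a‖ ≤ e := by
    filter_upwards [hK.ae_kernelMeasure hh p] with y hy using hfa y hy
  have hint : Integrable (fun y => f y - a) (kernelMeasure K h p) :=
    Integrable.of_bound (hf.sub_const a).aestronglyMeasurable e hae
  have hint' : Integrable f (kernelMeasure K h p) :=
    (hint.add (integrable_const a)).congr (ae_of_all _ fun y => by simp)
  have h1 : ∫ y, f y ∂kernelMeasure K h p - a = ∫ y, (f y - a) ∂kernelMeasure K h p := by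
    rw [integral_sub hint' (integrable_const a)]; simp
  rw [h1, ← Real.norm_eq_abs]
  simpa using norm_integral_le_of_norm_le_const hae

/-- With `x = 1 / w`, the number of grid points times the exponential tail bound. -/
theorem tendsto_card_mul_exp (R c : ℝ) (hc : 0 < c) (hR : 0 ≤ R) :
    Tendsto (fun x : ℝ => (2 * (R * x ^ (d + 2)) + 3) ^ d * (2 * Real.exp (-c * x))) atTop
      (𝓝 0) := by
  have h1 := (tendsto_rpow_mul_exp_neg_mul_atTop_nhds_zero (((d + 2) * d : ℕ) : ℝ) c hc).const_mul
    ((2 * R + 3) ^ d * 2)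
  rw [mul_zero] at h1
  refine squeeze_zero' ?_ ?_ h1
  · filter_upwards [eventually_ge_atTop 0] with x hx
    positivity
  · filter_upwards [eventually_ge_atTop 1] with x hx
    rw [Real.rpow_natCast, pow_mul]
    have : 2 * (R * x ^ (d + 2)) + 3 ≤ (2 * R + 3) * x ^ (d + 2) := by
      have := one_le_pow₀ hx (n := d + 2)
      linarith
    calc (2 * (R * x ^ (d + 2)) + 3) ^ d * (2 * Real.exp (-c * x))
        ≤ ((2 * R + 3) * x ^ (d + 2)) ^ d * (2 * Real.exp (-c * x)) := by
          gcongr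
      _ = _ := by rw [mul_pow]; ring

variable [IsProbabilityMeasure P]

/-- The kernel density estimator is uniformly consistent on a compact set near which the density
is uniformly continuous. Bernstein's inequality is applied on a grid of mesh `w ^ (d + 2)`, on
which the Lipschitz continuity of the kernel makes the oscillation of the estimator `O(w)`. -/
theorem tendsto_measure_densityEst {Ks : 𝔼 → ℝ} (hKs : IsKernel Ks) {L : ℝ≥0}
    (hL : LipschitzWith L Ks) {w : ℕ → ℝ} (hw0 : ∀ᶠ n in atTop, 0 < w n)
    (hwt : Tendsto w atTop (𝓝 0)) (hnw : ∀ᶠ n : ℕ in atTop, 1 ≤ n * w n ^ (d + 1))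
    {Z : ℕ → Ω → 𝔼} (hZ : ∀ i, Measurable (Z i)) (hind : iIndepFun Z P) {fZ : 𝔼 → ℝ}
    (hfZ : Measurable fZ) (hfZ0 : ∀ z, 0 ≤ fZ z)
    (hlaw : ∀ i, P.map (Z i) = volume.withDensity fun z => ENNReal.ofReal (fZ z))
    {I : Set 𝔼} (hI : IsCompact I) (f1 : DensityCondition fZ I) {e : ℝ} (he : 0 < e) :
    Tendsto (fun n => P {ω | ∃ z ∈ I,
      e ≤ |densityEst Ks (w n) n (fun i => Z i ω) z - fZ z|}) atTop (𝓝 0) := by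
  obtain ⟨κ, hκ, hKκ⟩ := hKs.exists_bound_of_lipschitzWith hL
  obtain ⟨B, hB, δ₁, hδ₁, hfB⟩ := f1.exists_bound hI
  obtain ⟨δ, hδ, hfe⟩ := f1.1 (e / 4) (by positivity)
  obtain ⟨R, hRpos, hR⟩ := hI.isBounded.exists_pos_norm_le
  -- the free parameter of Bernstein's inequality is `a * w ^ d`
  set a : ℝ := min (1 / κ) (e / (8 * κ * (B + e)))
  have ha : 0 < a := by positivity
  have haκ : a * κ ≤ 1 := by
    rw [← le_div_iff₀ hκ]; exact min_le_left _ _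
  have haB : a * (κ * (B + e)) ≤ e / 8 := by
    have := min_le_right (1 / κ) (e / (8 * κ * (B + e)))
    change a ≤ _ at this
    rw [le_div_iff₀ (by positivity)] at this
    linarith
  set c : ℝ := a * e / 8
  have hc : 0 < c := by positivity
  have hlim : Tendsto (fun n => ENNReal.ofReal
      ((2 * (R * (w n)⁻¹ ^ (d + 2)) + 3) ^ d * (2 * Real.exp (-c * (w n)⁻¹)))) atTop (𝓝 0) := by
    have h1 : Tendsto (fun n => (w n)⁻¹) atTop atTop :=
      tendsto_inv_nhdsGT_zero.comp (tendsto_nhdsWithin_iff.2 ⟨hwt, hw0⟩)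
    simpa using ENNReal.tendsto_ofReal ((tendsto_card_mul_exp (d := d) R c hc hRpos.le).comp h1)
  refine tendsto_of_tendsto_of_tendsto_of_le_of_le' tendsto_const_nhds hlim
    (Eventually.of_forall fun _ => zero_le) ?_
  have hsmall : Tendsto (fun n => √d * w n ^ (d + 2) + √d * w n) atTop (𝓝 0) := by
    simpa using ((hwt.pow (d + 2)).const_mul √d).add (hwt.const_mul √d)
  have hLip : Tendsto (fun n => L * √d * w n) atTop (𝓝 0) := by
    simpa using hwt.const_mul (L * √d)
  filter_upwards [hw0, hnw, hsmall.eventually (gt_mem_nhds hδ),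
    hLip.eventually (gt_mem_nhds (show 0 < e / 4 by positivity)), eventually_gt_atTop 0]
    with n hwn hnwn hsm hLn hn
  have hn' : (0 : ℝ) < n := by exact_mod_cast hn
  set v := w n
  have hvd : 0 < v ^ d := by positivity
  obtain ⟨T, hTcard, hT⟩ := exists_finset_cover hRpos.le hR (pow_pos hwn (d + 2))
  classical
  set T' := T.filter fun p => ∃ z ∈ I, dist z p ≤ √d * v ^ (d + 2)
  have hmeas := hKs.measurable_scaled v
  set X : 𝔼 → ℕ → Ω → ℝ := fun p i ω => scaled Ks v (p - Z i ω)
  have hXm : ∀ p i, Measurable (X p i) := fun p i => by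
    have := hZ i
    fun_prop
  have hX0 : ∀ p i ω, 0 ≤ X p i ω := fun p i ω => hKs.scaled_nonneg hwn _
  have hXM : ∀ p i ω, X p i ω ≤ κ / v ^ d := fun p i ω => by
    simp only [X, scaled]
    gcongr
    exact hKκ _
  have hXint : ∀ p i, ∫ ω, X p i ω ∂P = ∫ y, fZ y ∂kernelMeasure Ks v p := fun p i => by
    rw [hKs.integral_kernelMeasure hwn]
    exact integral_comp_of_law (hZ i) hfZ hfZ0 (hlaw i) (F := fun y => scaled Ks v (p - y))
      (by fun_prop)
  have hbias : ∀ z ∈ I, ∀ p, dist z p ≤ √d * v ^ (d + 2) →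
      |∫ y, fZ y ∂kernelMeasure Ks v p - fZ z| ≤ e / 4 := fun z hz p hzp =>
    hKs.abs_integral_kernelMeasure_sub_le hwn hfZ p fun y hy => by
      refine (hfe z hz y (lt_of_le_of_lt ?_ hsm)).le
      rw [← dist_eq_norm, dist_comm] at hy
      have := dist_triangle y p z
      rw [dist_comm p z] at this
      linarith
  have hmean : ∀ p ∈ T', ∫ y, fZ y ∂kernelMeasure Ks v p ≤ B + e := fun p hp => by
    obtain ⟨z, hz, hzp⟩ := (Finset.mem_filter.1 hp).2
    have h1 := (abs_le.1 (hbias z hz p hzp)).2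
    have h2 := hfB z hz z (by rwa [dist_self])
    linarith
  have hsq : ∀ p ∈ T', ∀ i, ∫ ω, X p i ω ^ 2 ∂P ≤ κ / v ^ d * (B + e) := fun p hp i => by
    have hXi : Integrable (X p i) P := Integrable.of_bound (hXm p i).aestronglyMeasurable
      (κ / v ^ d) (ae_of_all _ fun ω => by
        rw [Real.norm_of_nonneg (hX0 p i ω)]; exact hXM p i ω)
    calc ∫ ω, X p i ω ^ 2 ∂P ≤ ∫ ω, κ / v ^ d * X p i ω ∂P := by
          refine integral_mono_of_nonneg (ae_of_all _ fun ω => sq_nonneg _) (hXi.const_mul _)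
            (ae_of_all _ fun ω => ?_)
          simp only [sq]
          exact mul_le_mul_of_nonneg_right (hXM p i ω) (hX0 p i ω)
      _ = κ / v ^ d * ∫ y, fZ y ∂kernelMeasure Ks v p := by rw [integral_const_mul, hXint]
      _ ≤ _ := by gcongr; exact hmean p hp
  have hbern : ∀ p ∈ T', P {ω | n * (e / 4) ≤ |∑ i ∈ Finset.range n, (X p i ω - ∫ ω, X p i ω ∂P)|} ≤
      ENNReal.ofReal (2 * Real.exp (-c * v⁻¹)) := fun p hp => by
    have hindX : iIndepFun (X p) P :=
      hind.comp (fun _ y => scaled Ks v (p - y)) fun _ => by fun_prop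
    have h1 := measureReal_le_abs_sum_sub_mean (hXm p) hindX (hX0 p) (hXM p) (hsq p hp)
      (t := a * v ^ d) (e := e / 4) (by positivity)
      (by rw [mul_assoc, mul_div_cancel₀ _ hvd.ne']; exact haκ) n
    rw [← ofReal_measureReal]
    refine ENNReal.ofReal_le_ofReal (h1.trans ?_)
    gcongr
    have h2 : v⁻¹ ≤ n * v ^ d := by
      rw [inv_le_iff_one_le_mul₀ hwn]
      calc (1 : ℝ) ≤ n * v ^ (d + 1) := hnwn
        _ = n * v ^ d * v := by ring
    have h3 : (a * v ^ d) ^ 2 * (κ / v ^ d * (B + e)) = v ^ d * a * (a * (κ * (B + e))) := by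
      field_simp
    rw [h3]
    calc -(a * v ^ d * (n * (e / 4))) + n * (v ^ d * a * (a * (κ * (B + e))))
        ≤ -(a * v ^ d * (n * (e / 4))) + n * (v ^ d * a * (e / 8)) := by gcongr
      _ = -(c * (n * v ^ d)) := by simp only [c]; ring
      _ ≤ -(c * v⁻¹) := by gcongr
      _ = -c * v⁻¹ := by ring
  calc P {ω | ∃ z ∈ I, e ≤ |densityEst Ks v n (fun i => Z i ω) z - fZ z|}
      ≤ P (⋃ p ∈ T', {ω | n * (e / 4) ≤
          |∑ i ∈ Finset.range n, (X p i ω - ∫ ω, X p i ω ∂P)|}) := by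
        refine measure_mono fun ω ⟨z, hz, hez⟩ => ?_
        obtain ⟨p, hpT, hzp⟩ := hT z hz
        refine Set.mem_iUnion₂.2 ⟨p, Finset.mem_filter.2 ⟨hpT, z, hz, hzp⟩, ?_⟩
        by_contra hcon
        rw [Set.mem_ofPred_eq, not_le] at hcon
        have h1 : |densityEst Ks v n (fun i => Z i ω) z - densityEst Ks v n (fun i => Z i ω) p| ≤
            L * √d * v := by
          unfold densityEst
          rw [← mul_sub, ← Finset.sum_sub_distrib, abs_mul, abs_of_pos (inv_pos.2 hn'),
            inv_mul_le_iff₀ hn']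
          refine (Finset.abs_sum_le_sum_abs _ _).trans ?_
          calc ∑ i ∈ Finset.range n, |scaled Ks v (z - Z i ω) - scaled Ks v (p - Z i ω)|
              ≤ ∑ _i ∈ Finset.range n, L * √d * v := by
                refine Finset.sum_le_sum fun i _ => (abs_scaled_sub_le hL hwn _ _).trans ?_
                rw [dist_sub_right]
                calc L / v ^ (d + 1) * dist z p ≤ L / v ^ (d + 1) * (√d * v ^ (d + 2)) := by
                      gcongr
                  _ = L * √d * v := by field_simp; ring
            _ = n * (L * √d * v) := by simp
        have h2 : |densityEst Ks v n (fun i => Z i ω) p - ∫ y, fZ y ∂kernelMeasure Ks v p| <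
            e / 4 := by
          have h3 : densityEst Ks v n (fun i => Z i ω) p - ∫ y, fZ y ∂kernelMeasure Ks v p =
              (n : ℝ)⁻¹ * ∑ i ∈ Finset.range n, (X p i ω - ∫ ω, X p i ω ∂P) := by
            rw [Finset.sum_sub_distrib]
            simp_rw [hXint]
            rw [Finset.sum_const, Finset.card_range, mul_sub, nsmul_eq_mul,
              inv_mul_cancel_left₀ hn'.ne']
            rfl
          rw [h3, abs_mul, abs_of_pos (inv_pos.2 hn'), inv_mul_lt_iff₀ hn']
          exact hcon
        have h4 := hbias z hz p hzp
        have h5 : |densityEst Ks v n (fun i => Z i ω) z - fZ z| ≤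
            |densityEst Ks v n (fun i => Z i ω) z - densityEst Ks v n (fun i => Z i ω) p| +
            |densityEst Ks v n (fun i => Z i ω) p - ∫ y, fZ y ∂kernelMeasure Ks v p| +
            |∫ y, fZ y ∂kernelMeasure Ks v p - fZ z| :=
          (abs_sub_le _ (∫ y, fZ y ∂kernelMeasure Ks v p) _).trans
            (add_le_add_left (abs_sub_le _ _ _) _)
        linarith
    _ ≤ ∑ p ∈ T', P {ω | n * (e / 4) ≤
          |∑ i ∈ Finset.range n, (X p i ω - ∫ ω, X p i ω ∂P)|} := measure_biUnion_finset_le _ _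
    _ ≤ ∑ _p ∈ T', ENNReal.ofReal (2 * Real.exp (-c * v⁻¹)) := Finset.sum_le_sum hbern
    _ = ENNReal.ofReal (T'.card * (2 * Real.exp (-c * v⁻¹))) := by
        rw [Finset.sum_const, nsmul_eq_mul, ENNReal.ofReal_mul (Nat.cast_nonneg _),
          ENNReal.ofReal_natCast]
    _ ≤ _ := by
        gcongr
        refine (Nat.cast_le.2 (Finset.card_filter_le _ _)).trans (hTcard.trans_eq ?_)
        rw [div_eq_mul_inv, inv_pow]

end DensityEstimator

/-! ### Mean squared error of the kernel-weighted averages -/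

section SquareIntegrals

variable {α : Type*} [MeasurableSpace α]

theorem memLp_two_iff_lintegral {μ : Measure α} {f : α → ℝ} (hf : AEStronglyMeasurable f μ) :
    MemLp f 2 μ ↔ ∫⁻ x, ENNReal.ofReal (f x ^ 2) ∂μ < ∞ := by
  rw [lintegral_ofReal_sq_eq, ENNReal.pow_lt_top_iff]
  exact ⟨fun h => Or.inl h.2, fun h => ⟨hf, h.resolve_right two_ne_zero⟩⟩

/-- If `f` is not integrable, the right side is infinite, so the junk value of `∫ f` on the left
does not matter. -/
theorem ofReal_sq_integral_sub_le (ν : Measure α) [IsProbabilityMeasure ν] {f : α → ℝ}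
    (hf : AEStronglyMeasurable f ν) (a : ℝ) :
    ENNReal.ofReal ((∫ x, f x ∂ν - a) ^ 2) ≤ ∫⁻ x, ENNReal.ofReal ((f x - a) ^ 2) ∂ν := by
  rcases eq_or_ne (∫⁻ x, ENNReal.ofReal ((f x - a) ^ 2) ∂ν) ∞ with htop | htop
  · rw [htop]; exact le_top
  have hsub : AEStronglyMeasurable (fun x => f x - a) ν := hf.sub aestronglyMeasurable_const
  have hint : Integrable (fun x => f x - a) ν :=
    ((memLp_two_iff_lintegral hsub).2 htop.lt_top).integrable (by norm_num)
  have hint' : Integrable f ν :=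
    (hint.add (integrable_const a)).congr (ae_of_all _ fun y => by simp)
  have h1 : ∫ x, f x ∂ν - a = ∫ x, (f x - a) ∂ν := by
    rw [integral_sub hint' (integrable_const a)]; simp
  rw [h1]
  exact ofReal_sq_integral_le ν _

/-- Variance plus squared bias, for the average of a sample. -/
theorem lintegral_sq_average_sub_le {P : Measure α} [IsProbabilityMeasure P] {ξ : ℕ → α → ℝ}
    (hm : ∀ i, Measurable (ξ i)) (hind : iIndepFun ξ P) (hid : ∀ i, IdentDistrib (ξ i) (ξ 0) P P)
    (hint : Integrable (ξ 0) P) (c : ℝ) {n : ℕ} (hn : 0 < n) :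
    ∫⁻ ω, ENNReal.ofReal (((n : ℝ)⁻¹ * ∑ i ∈ Finset.range n, ξ i ω - c) ^ 2) ∂P ≤
      (n : ℝ≥0∞)⁻¹ * ∫⁻ ω, ENNReal.ofReal (ξ 0 ω ^ 2) ∂P +
        ENNReal.ofReal ((∫ ω, ξ 0 ω ∂P - c) ^ 2) := by
  have hn' : (n : ℝ) ≠ 0 := by exact_mod_cast hn.ne'
  by_cases h0 : MemLp (ξ 0) 2 P
  swap
  · have : ∫⁻ ω, ENNReal.ofReal (ξ 0 ω ^ 2) ∂P = ∞ := by
      by_contra h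
      exact h0 ((memLp_two_iff_lintegral hint.1).2 (lt_top_iff_ne_top.2 h))
    rw [this, ENNReal.mul_top (by simp), top_add]
    exact le_top
  have hξ : ∀ i, MemLp (ξ i) 2 P := fun i => (hid i).symm.memLp_snd h0
  set S : α → ℝ := fun ω => (n : ℝ)⁻¹ * ∑ i ∈ Finset.range n, ξ i ω
  have hsum : MemLp (∑ i ∈ Finset.range n, ξ i) 2 P := memLp_finsetSum' _ fun i _ => hξ i
  have hSeq : S = fun ω => (n : ℝ)⁻¹ * (∑ i ∈ Finset.range n, ξ i) ω := by
    ext ω; simp [S]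
  have hS : MemLp S 2 P := by
    rw [hSeq]; exact hsum.const_mul _
  have hSc : MemLp (fun ω => S ω - c) 2 P := hS.sub (memLp_const c)
  have hvar : Var[S; P] = (n : ℝ)⁻¹ * Var[ξ 0; P] := by
    rw [hSeq, variance_const_mul, IndepFun.variance_sum (fun i _ => hξ i)
      (fun i _ j _ hij => hind.indepFun hij)]
    simp_rw [(hid _).variance_eq]
    simp only [Finset.sum_const, Finset.card_range, nsmul_eq_mul]
    field_simp
  have hmean : ∫ ω, S ω ∂P = ∫ ω, ξ 0 ω ∂P := by
    simp only [S]
    rw [integral_const_mul, integral_finsetSum _ fun i _ => (hξ i).integrable (by norm_num)]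
    simp_rw [(hid _).integral_eq]
    simp [hn']
  have hmse : ∫ ω, (S ω - c) ^ 2 ∂P = Var[S; P] + (∫ ω, ξ 0 ω ∂P - c) ^ 2 := by
    have h1 := variance_eq_sub hSc
    rw [variance_sub_const hS.1, integral_sub (hS.integrable (by norm_num)) (integrable_const c),
      hmean] at h1
    simp only [integral_const, probReal_univ, smul_eq_mul, one_mul, Pi.pow_apply] at h1
    linarith
  have hle : Var[ξ 0; P] ≤ ∫ ω, ξ 0 ω ^ 2 ∂P := by
    simpa using variance_le_expectation_sq (μ := P) (hm 0).aestronglyMeasurable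
  rw [← ofReal_integral_eq_lintegral_ofReal hSc.integrable_sq (ae_of_all _ fun _ => sq_nonneg _),
    ← ofReal_integral_eq_lintegral_ofReal h0.integrable_sq (ae_of_all _ fun _ => sq_nonneg _),
    hmse, hvar, ENNReal.ofReal_add (mul_nonneg (by positivity) (variance_nonneg _ _))
      (sq_nonneg _), ENNReal.ofReal_mul (by positivity), ENNReal.ofReal_inv_of_pos (by positivity),
    ENNReal.ofReal_natCast]
  gcongr

end SquareIntegrals

/-- The mean squared oscillation of `φ` around `z` under the kernel of bandwidth `h`; it bounds
the squared bias of the kernel average of `φ` at `z`. -/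
noncomputable def oscillation (K : 𝔼 → ℝ) (h : ℝ) (φ : 𝔼 → ℝ) (z : 𝔼) : ℝ≥0∞ :=
  ∫⁻ y, ENNReal.ofReal ((φ y - φ z) ^ 2) ∂kernelMeasure K h z

theorem IsKernel.lintegral_kernelMeasure {K : 𝔼 → ℝ} (hK : IsKernel K) (h : ℝ) (z : 𝔼)
    {F : 𝔼 → ℝ≥0∞} (hF : Measurable F) : ∫⁻ y, F y ∂kernelMeasure K h z =
      ∫⁻ y, ENNReal.ofReal (scaled K h (z - y)) * F y := by
  have := hK.measurable_scaled h
  rw [kernelMeasure, lintegral_withDensity_eq_lintegral_mul _ (by fun_prop) hF]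
  rfl

theorem IsKernel.measurable_oscillation {K : 𝔼 → ℝ} (hK : IsKernel K) (h : ℝ) {φ : 𝔼 → ℝ}
    (hφ : Measurable φ) : Measurable (oscillation K h φ) := by
  have := hK.measurable_scaled h
  have h1 : oscillation K h φ = fun z => ∫⁻ y, ENNReal.ofReal (scaled K h (z - y)) *
      ENNReal.ofReal ((φ y - φ z) ^ 2) := by
    ext z
    exact hK.lintegral_kernelMeasure h z (by fun_prop)
  rw [h1]
  refine Measurable.lintegral_prod_right' (f := fun p : 𝔼 × 𝔼 =>
    ENNReal.ofReal (scaled K h (p.1 - p.2)) * ENNReal.ofReal ((φ p.2 - φ p.1) ^ 2)) ?_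
  fun_prop

theorem IsKernel.tendsto_lintegral_oscillation_of_bounded {K : 𝔼 → ℝ} (hK : IsKernel K)
    {h : ℕ → ℝ} (hpos : ∀ n, 0 < h n) (h1 : Tendsto h atTop (𝓝 0)) {φ : 𝔼 → ℝ}
    (hφ : Measurable φ) {C : ℝ} (hC : ∀ z, |φ z| ≤ C) (G : Measure 𝔼) [IsFiniteMeasure G]
    (hcont : ∀ᵐ z ∂G, ContinuousAt φ z) :
    Tendsto (fun n => ∫⁻ z, oscillation K (h n) φ z ∂G) atTop (𝓝 0) := by
  have hsq : ∀ y z, (φ y - φ z) ^ 2 ≤ (2 * C) ^ 2 := fun y z => by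
    rw [sq_le_sq]
    refine ((abs_sub _ _).trans (add_le_add (hC y) (hC z))).trans ?_
    rw [← two_mul]
    exact le_abs_self _
  have hP := fun n z => hK.isProbabilityMeasure_kernelMeasure (hpos n) z
  have key := tendsto_lintegral_of_dominated_convergence (μ := G)
    (F := fun n => oscillation K (h n) φ)
    (f := fun _ => 0) (fun _ => ENNReal.ofReal ((2 * C) ^ 2))
    (fun n => hK.measurable_oscillation (h n) hφ)
    (fun n => ae_of_all _ fun z => ?_) ?_ ?_
  · simpa using key
  · calc oscillation K (h n) φ z ≤ ∫⁻ _y, ENNReal.ofReal ((2 * C) ^ 2) ∂kernelMeasure K (h n) z :=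
          lintegral_mono fun y => ENNReal.ofReal_le_ofReal (hsq y z)
      _ = ENNReal.ofReal ((2 * C) ^ 2) := by simp
  · simpa using ENNReal.mul_ne_top ENNReal.ofReal_ne_top (measure_ne_top G _)
  · filter_upwards [hcont] with z hz
    rw [ENNReal.tendsto_nhds_zero]
    intro e he
    obtain ⟨e', he'0, he'⟩ : ∃ e' : ℝ, 0 < e' ∧ ENNReal.ofReal (e' ^ 2) ≤ e := by
      rcases eq_or_ne e ∞ with rfl | hetop
      · exact ⟨1, one_pos, le_top⟩
      · refine ⟨√e.toReal, Real.sqrt_pos.2 (ENNReal.toReal_pos he.ne' hetop), ?_⟩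
        rw [Real.sq_sqrt ENNReal.toReal_nonneg, ENNReal.ofReal_toReal hetop]
    obtain ⟨δ, hδ, hφδ⟩ := Metric.continuousAt_iff.1 hz e' he'0
    have hsm : Tendsto (fun n => √d * h n) atTop (𝓝 0) := by simpa using h1.const_mul √d
    filter_upwards [hsm.eventually (gt_mem_nhds hδ)] with n hn
    refine le_trans ?_ he'
    calc oscillation K (h n) φ z ≤ ∫⁻ _y, ENNReal.ofReal (e' ^ 2) ∂kernelMeasure K (h n) z := by
          refine lintegral_mono_ae ?_
          filter_upwards [hK.ae_kernelMeasure (hpos n) z] with y hy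
          refine ENNReal.ofReal_le_ofReal ?_
          rw [← dist_eq_norm, dist_comm] at hy
          have := hφδ (hy.trans_lt hn)
          rw [Real.dist_eq] at this
          rw [sq_le_sq, abs_of_pos he'0]
          exact this.le
      _ = ENNReal.ofReal (e' ^ 2) := by simp

theorem lintegral_le_mul_of_hasBoundedDensity {G : Measure 𝔼} (hG : HasBoundedDensity G) :
    ∃ C : ℝ≥0, ∀ F : 𝔼 → ℝ≥0∞, ∫⁻ z, F z ∂G ≤ C * ∫⁻ z, F z := by
  obtain ⟨g, C, hg, hgC, rfl⟩ := hG
  refine ⟨C, fun F => ?_⟩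
  have h1 : volume.withDensity (fun z => (g z : ℝ≥0∞)) ≤ (C : ℝ≥0∞) • (volume : Measure 𝔼) := by
    rw [← withDensity_const]
    exact withDensity_mono (ae_of_all _ fun z => ENNReal.coe_le_coe.2 (hgC z))
  refine (lintegral_mono' h1 le_rfl).trans_eq ?_
  rw [lintegral_smul_measure, smul_eq_mul]

theorem ofReal_sq_add_add_le (a b c : ℝ) : ENNReal.ofReal ((a + b + c) ^ 2) ≤
    3 * (ENNReal.ofReal (a ^ 2) + ENNReal.ofReal (b ^ 2) + ENNReal.ofReal (c ^ 2)) := by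
  rw [← ENNReal.ofReal_add (sq_nonneg _) (sq_nonneg _), ← ENNReal.ofReal_add (by positivity)
    (sq_nonneg _), show (3 : ℝ≥0∞) = ENNReal.ofReal 3 by simp, ← ENNReal.ofReal_mul (by norm_num)]
  refine ENNReal.ofReal_le_ofReal ?_
  nlinarith [sq_nonneg (a - b), sq_nonneg (a - c), sq_nonneg (b - c)]

/-- No continuity of `φ` is needed against a measure with bounded density, as `φ` is approximated
in `L²` by a continuous function with compact support. -/
theorem IsKernel.tendsto_lintegral_oscillation_of_hasBoundedDensity {K : 𝔼 → ℝ}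
    (hK : IsKernel K) {h : ℕ → ℝ} (hpos : ∀ n, 0 < h n) (h1 : Tendsto h atTop (𝓝 0))
    {φ : 𝔼 → ℝ} (hφ : Measurable φ) (hφ2 : MemLp φ 2 volume) (G : Measure 𝔼) [IsFiniteMeasure G]
    (hG : HasBoundedDensity G) :
    Tendsto (fun n => ∫⁻ z, oscillation K (h n) φ z ∂G) atTop (𝓝 0) := by
  obtain ⟨C, hC⟩ := lintegral_le_mul_of_hasBoundedDensity hG
  have main : ∀ a : ℝ≥0, 0 < a → ∀ᶠ n in atTop,
      ∫⁻ z, oscillation K (h n) φ z ∂G ≤ 3 * (C * a + a * G Set.univ + C * a) := by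
    intro a ha
    obtain ⟨ψ, hψc, hψ, hψcont, -⟩ := hφ2.exists_hasCompactSupport_eLpNorm_sub_le (by norm_num)
      (ε := (NNReal.sqrt a : ℝ≥0∞)) (by simpa using ha.ne')
    have hψm : Measurable ψ := hψcont.measurable
    set D : 𝔼 → ℝ≥0∞ := fun y => ENNReal.ofReal ((φ y - ψ y) ^ 2)
    have hDm : Measurable D := by fun_prop
    have hD : ∫⁻ y, D y ≤ a := by
      have : ∫⁻ y, D y = eLpNorm (φ - ψ) 2 volume ^ 2 := lintegral_ofReal_sq_eq (φ - ψ)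
      rw [this]
      calc eLpNorm (φ - ψ) 2 volume ^ 2 ≤ (NNReal.sqrt a : ℝ≥0∞) ^ 2 := by gcongr
        _ = (a : ℝ≥0∞) := by rw [← ENNReal.coe_pow, NNReal.sq_sqrt]
    have hunif : UniformContinuous ψ := hψc.uniformContinuous_of_continuous hψcont
    obtain ⟨δ, hδ, hψδ⟩ := Metric.uniformContinuous_iff.1 hunif √a (by positivity)
    have hsm : Tendsto (fun n => √d * h n) atTop (𝓝 0) := by simpa using h1.const_mul √d
    filter_upwards [hsm.eventually (gt_mem_nhds hδ)] with n hn
    have hKm := hK.measurable_scaled (h n)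
    have hP := fun z => hK.isProbabilityMeasure_kernelMeasure (hpos n) z
    have hpt : ∀ z, oscillation K (h n) φ z ≤
        3 * (∫⁻ y, D y ∂kernelMeasure K (h n) z + a + D z) := fun z => by
      calc oscillation K (h n) φ z
          ≤ ∫⁻ y, 3 * (D y + a + D z) ∂kernelMeasure K (h n) z := by
            refine lintegral_mono_ae ?_
            filter_upwards [hK.ae_kernelMeasure (hpos n) z] with y hy
            rw [← dist_eq_norm, dist_comm] at hy
            have hyz := hψδ (hy.trans_lt hn)
            rw [Real.dist_eq] at hyz
            have hsplit : φ y - φ z = (φ y - ψ y) + (ψ y - ψ z) + (ψ z - φ z) := by ring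
            rw [hsplit]
            refine (ofReal_sq_add_add_le _ _ _).trans ?_
            rw [← neg_sq (ψ z - φ z), neg_sub]
            gcongr
            rw [← ENNReal.ofReal_coe_nnreal]
            refine ENNReal.ofReal_le_ofReal ?_
            rw [← Real.sq_sqrt a.coe_nonneg, sq_le_sq, abs_of_nonneg (Real.sqrt_nonneg _)]
            exact hyz.le
        _ = _ := by
            rw [lintegral_const_mul _ (by fun_prop), lintegral_add_right _ measurable_const,
              lintegral_add_right _ measurable_const]
            simp
    have hKD : ∫⁻ z, ∫⁻ y, D y ∂kernelMeasure K (h n) z = ∫⁻ y, D y := by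
      simp_rw [hK.lintegral_kernelMeasure (h n) _ hDm]
      rw [lintegral_lintegral_swap (by fun_prop)]
      refine lintegral_congr fun y => ?_
      rw [lintegral_mul_const _ (by fun_prop)]
      simp_rw [hK.scaled_sub_comm (h n) _ y]
      rw [hK.lintegral_scaled (hpos n), one_mul]
    have hmeas1 : Measurable fun z => ∫⁻ y, D y ∂kernelMeasure K (h n) z := by
      simp_rw [hK.lintegral_kernelMeasure (h n) _ hDm]
      refine Measurable.lintegral_prod_right' (f := fun p : 𝔼 × 𝔼 =>
        ENNReal.ofReal (scaled K (h n) (p.1 - p.2)) * D p.2) ?_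
      fun_prop
    calc ∫⁻ z, oscillation K (h n) φ z ∂G
        ≤ ∫⁻ z, 3 * (∫⁻ y, D y ∂kernelMeasure K (h n) z + a + D z) ∂G := lintegral_mono hpt
      _ = 3 * (∫⁻ z, ∫⁻ y, D y ∂kernelMeasure K (h n) z ∂G + a * G Set.univ + ∫⁻ z, D z ∂G) := by
          rw [lintegral_const_mul _ (by fun_prop), lintegral_add_right _ hDm,
            lintegral_add_right _ measurable_const, lintegral_const]
      _ ≤ _ := by
          gcongr
          · exact (hC _).trans (by rw [hKD]; gcongr)
          · exact (hC _).trans (by gcongr)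
  rw [ENNReal.tendsto_nhds_zero]
  intro e he
  have hlim : Tendsto (fun a : ℝ≥0 => 3 * (C * (a : ℝ≥0∞) + a * G Set.univ + C * a)) (𝓝[>] 0)
      (𝓝 0) := by
    have hid : Tendsto (fun a : ℝ≥0 => (a : ℝ≥0∞)) (𝓝[>] 0) (𝓝 0) :=
      (ENNReal.tendsto_coe.2 tendsto_id).mono_left nhdsWithin_le_nhds
    have hC1 := ENNReal.Tendsto.const_mul (a := (C : ℝ≥0∞)) hid (Or.inr ENNReal.coe_ne_top)
    have hG1 := ENNReal.Tendsto.mul_const (b := G Set.univ) hid (Or.inr (measure_ne_top _ _))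
    have := ENNReal.Tendsto.const_mul (a := 3) ((hC1.add hG1).add hC1) (Or.inr (by simp))
    simpa using this
  obtain ⟨a, ha, ha0⟩ := ((hlim.eventually (ge_mem_nhds he)).and self_mem_nhdsWithin).exists
  filter_upwards [main a ha0] with n hn using hn.trans ha

/-! ### Consistency of the kernel regression estimator in `L²(G)` -/

section Regression

variable {Ω : Type*} [MeasurableSpace Ω] {P : Measure Ω}

/-- The pairs `(Z_i, V_i)` are i.i.d., `Z_i` has density `f`, `V_i` is square integrable, and `r`
is a version of the regression function `E[V | Z = ·]`. The last property is expressed by testing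
against the functions `ψ` with `ψ(Z)` square integrable. -/
structure IsRegressionSample (P : Measure Ω) (Z : ℕ → Ω → 𝔼) (V : ℕ → Ω → ℝ) (f r : 𝔼 → ℝ) :
    Prop where
  measurable_Z : ∀ i, Measurable (Z i)
  measurable_V : ∀ i, Measurable (V i)
  measurable_f : Measurable f
  f_nonneg : ∀ z, 0 ≤ f z
  law_Z : ∀ i, P.map (Z i) = volume.withDensity fun z => ENNReal.ofReal (f z)
  indep : iIndepFun (fun i ω => (Z i ω, V i ω)) P
  ident : ∀ i, P.map (fun ω => (Z i ω, V i ω)) = P.map (fun ω => (Z 0 ω, V 0 ω))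
  memLp_V : MemLp (V 0) 2 P
  measurable_r : Measurable r
  memLp_r : MemLp (fun ω => r (Z 0 ω)) 2 P
  regression : ∀ ψ : 𝔼 → ℝ, Measurable ψ → MemLp (fun ω => ψ (Z 0 ω)) 2 P →
    ∫ ω, ψ (Z 0 ω) * V 0 ω ∂P = ∫ ω, ψ (Z 0 ω) * r (Z 0 ω) ∂P

/-- The dichotomy under which the mean squared error may be integrated against `G`: `G` has a
bounded density, or else `r` is `G`-almost everywhere continuous and, near `I`, both `r` and the
conditional second moment of `V` given `Z` are bounded. The bound `E[V² | Z] ≤ C` on `U` is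
expressed by testing against nonnegative functions supported in `U`. -/
def IsTame (P : Measure Ω) (G : Measure 𝔼) (I : Set 𝔼) (ζ : Ω → 𝔼) (v : Ω → ℝ) (r : 𝔼 → ℝ) :
    Prop :=
  HasBoundedDensity G ∨ ∃ (U : Set 𝔼) (C : ℝ≥0), IsOpen U ∧ I ⊆ U ∧ (∀ z ∈ U, |r z| ≤ C) ∧
    (∀ᵐ z ∂G, ContinuousAt r z) ∧
    ∀ ψ : 𝔼 → ℝ≥0∞, Measurable ψ → (∀ y ∉ U, ψ y = 0) →
      ∫⁻ ω, ψ (ζ ω) * ENNReal.ofReal (v ω ^ 2) ∂P ≤ C * ∫⁻ ω, ψ (ζ ω) ∂P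

/-- The kernel estimator of `f r`, the numerator of the regression estimator. -/
noncomputable def numeratorEst (K : 𝔼 → ℝ) (h : ℝ) (n : ℕ) (Zs : ℕ → 𝔼) (Vs : ℕ → ℝ) (z : 𝔼) : ℝ :=
  (n : ℝ)⁻¹ * ∑ i ∈ Finset.range n, scaled K h (z - Zs i) * Vs i

theorem tendsto_mul_pow_atTop {h : ℕ → ℝ} (hpos : ∀ n, 0 < h n) (h1 : Tendsto h atTop (𝓝 0))
    (h2 : Tendsto (fun n : ℕ => (n : ℝ) * h n ^ (2 * d)) atTop atTop) :
    Tendsto (fun n : ℕ => (n : ℝ) * h n ^ d) atTop atTop := by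
  refine tendsto_atTop_mono' _ ?_ h2
  filter_upwards [h1.eventually (gt_mem_nhds one_pos)] with n hn
  gcongr ?_ * ?_
  exact pow_le_pow_of_le_one (hpos n).le hn.le (by omega)

/-- The variance contribution, integrated against `G`, is of order `1 / h ^ d`. -/
theorem IsRegressionSample.exists_lintegral_sq_le {Z : ℕ → Ω → 𝔼} {V : ℕ → Ω → ℝ} {f r : 𝔼 → ℝ}
    [IsProbabilityMeasure P]
    (hs : IsRegressionSample P Z V f r) {K : 𝔼 → ℝ} (hK : IsKernel K) {I : Set 𝔼}
    (hI : IsCompact I) (f1 : DensityCondition f I) (G : Measure 𝔼) [IsFiniteMeasure G]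
    (hGI : G Iᶜ = 0) (htame : IsTame P G I (Z 0) (V 0) r) :
    ∃ (C : ℝ≥0∞) (δ : ℝ), C < ∞ ∧ 0 < δ ∧ ∀ h, 0 < h → √d * h < δ →
      ∫⁻ z, ∫⁻ ω, ENNReal.ofReal ((scaled K h (z - Z 0 ω) * V 0 ω) ^ 2) ∂P ∂G ≤
        C / ENNReal.ofReal (h ^ d) := by
  have hZm := hs.measurable_Z 0
  have hVm := hs.measurable_V 0
  have hfm := hs.measurable_f
  rcases htame with hG | ⟨U, C, hU, hIU, -, -, hmom⟩
  · obtain ⟨C, hC⟩ := lintegral_le_mul_of_hasBoundedDensity hG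
    refine ⟨C * (kernelEnergy K * ∫⁻ ω, ENNReal.ofReal (V 0 ω ^ 2) ∂P), 1, ?_, one_pos,
      fun h hh _ => ?_⟩
    · exact ENNReal.mul_lt_top ENNReal.coe_lt_top (ENNReal.mul_lt_top hK.kernelEnergy_lt_top
        ((memLp_two_iff_lintegral hs.memLp_V.1).1 hs.memLp_V))
    · have hKm := hK.measurable_scaled h
      calc ∫⁻ z, ∫⁻ ω, ENNReal.ofReal ((scaled K h (z - Z 0 ω) * V 0 ω) ^ 2) ∂P ∂G
          ≤ C * ∫⁻ z, ∫⁻ ω, ENNReal.ofReal ((scaled K h (z - Z 0 ω) * V 0 ω) ^ 2) ∂P := hC _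
        _ = C * ∫⁻ ω, (kernelEnergy K / ENNReal.ofReal (h ^ d)) *
              ENNReal.ofReal (V 0 ω ^ 2) ∂P := by
            rw [lintegral_lintegral_swap (by fun_prop)]
            congr 1
            refine lintegral_congr fun ω => ?_
            simp_rw [mul_pow, ENNReal.ofReal_mul (sq_nonneg (scaled K h _))]
            rw [lintegral_mul_const _ (by fun_prop)]
            simp_rw [hK.scaled_sub_comm h _ (Z 0 ω)]
            rw [hK.lintegral_scaled_sq hh]
        _ = _ := by
            rw [lintegral_const_mul _ (by fun_prop)]
            simp only [div_eq_mul_inv]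
            ring
  · obtain ⟨B, hB, δ₁, hδ₁, hfB⟩ := f1.exists_bound hI
    obtain ⟨δ₂, hδ₂, hδU⟩ := hI.exists_thickening_subset_open hU hIU
    refine ⟨C * (ENNReal.ofReal B * kernelEnergy K) * G Set.univ, min δ₁ δ₂, ?_, lt_min hδ₁ hδ₂,
      fun h hh hδ => ?_⟩
    · exact ENNReal.mul_lt_top (ENNReal.mul_lt_top ENNReal.coe_lt_top
        (ENNReal.mul_lt_top ENNReal.ofReal_lt_top hK.kernelEnergy_lt_top)) (measure_lt_top _ _)
    · have hKm := hK.measurable_scaled h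
      have hsupp : ∀ z ∈ I, ∀ y, scaled K h (z - y) ≠ 0 → dist y z < min δ₁ δ₂ := fun z _ y hy => by
        have := hK.norm_le_of_scaled_ne_zero hh hy
        rw [← dist_eq_norm, dist_comm] at this
        exact this.trans_lt hδ
      have hpt : ∀ᵐ z ∂G, ∫⁻ ω, ENNReal.ofReal ((scaled K h (z - Z 0 ω) * V 0 ω) ^ 2) ∂P ≤
          C * (ENNReal.ofReal B * (kernelEnergy K / ENNReal.ofReal (h ^ d))) := by
        filter_upwards [measure_eq_zero_iff_ae_notMem.1 hGI] with z hz
        rw [Set.notMem_compl_iff] at hz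
        simp_rw [mul_pow, ENNReal.ofReal_mul (sq_nonneg (scaled K h _))]
        refine (hmom (fun y => ENNReal.ofReal (scaled K h (z - y) ^ 2)) (by fun_prop)
          fun y hy => ?_).trans ?_
        · by_contra h0
          refine hy (hδU (Metric.mem_thickening_iff.2 ⟨z, hz, ?_⟩))
          exact (hsupp z hz y fun h00 => h0 (by simp [h00])).trans_le (min_le_right _ _)
        · gcongr
          rw [lintegral_comp_of_law hZm hfm (hs.law_Z 0)
            (F := fun y => ENNReal.ofReal (scaled K h (z - y) ^ 2)) (by fun_prop),
            ← hK.lintegral_scaled_sq hh z, ← lintegral_const_mul _ (by fun_prop)]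
          refine lintegral_mono fun y => ?_
          by_cases h0 : scaled K h (z - y) = 0
          · simp [h0]
          · gcongr
            exact hfB z hz y ((hsupp z hz y h0).trans_le (min_le_left _ _))
      refine (lintegral_mono_ae hpt).trans_eq ?_
      rw [lintegral_const]
      simp only [div_eq_mul_inv]
      ring

theorem IsRegressionSample.memLp_scaled [IsProbabilityMeasure P] {Z : ℕ → Ω → 𝔼} {V : ℕ → Ω → ℝ}
    {f r : 𝔼 → ℝ} (hs : IsRegressionSample P Z V f r) {K : 𝔼 → ℝ} (hK : IsKernel K) {h B : ℝ}
    (hh : 0 < h) {z : 𝔼} (hB : ∀ y, ‖z - y‖ ≤ √d * h → f y ≤ B) :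
    MemLp (fun ω => scaled K h (z - Z 0 ω)) 2 P := by
  have hZm := hs.measurable_Z 0
  have hfm := hs.measurable_f
  have hKm := hK.measurable_scaled h
  have hm : Measurable fun ω => scaled K h (z - Z 0 ω) := by fun_prop
  refine (memLp_two_iff_lintegral hm.aestronglyMeasurable).2 ?_
  rw [lintegral_comp_of_law hZm hfm (hs.law_Z 0)
    (F := fun y => ENNReal.ofReal (scaled K h (z - y) ^ 2)) (by fun_prop)]
  calc ∫⁻ y, ENNReal.ofReal (f y) * ENNReal.ofReal (scaled K h (z - y) ^ 2)
      ≤ ∫⁻ y, ENNReal.ofReal B * ENNReal.ofReal (scaled K h (z - y) ^ 2) := by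
        refine lintegral_mono fun y => ?_
        by_cases h0 : scaled K h (z - y) = 0
        · simp [h0]
        · gcongr
          exact hB y (hK.norm_le_of_scaled_ne_zero hh h0)
    _ < ∞ := by
        rw [lintegral_const_mul _ (by fun_prop), hK.lintegral_scaled_sq hh]
        refine ENNReal.mul_lt_top ENNReal.ofReal_lt_top
          (ENNReal.div_lt_top hK.kernelEnergy_lt_top.ne ?_)
        have : 0 < h ^ d := by positivity
        simpa using this

theorem IsRegressionSample.identDistrib {Z : ℕ → Ω → 𝔼} {V : ℕ → Ω → ℝ}
    {f r : 𝔼 → ℝ} (hs : IsRegressionSample P Z V f r) (i : ℕ) :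
    IdentDistrib (fun ω => (Z i ω, V i ω)) (fun ω => (Z 0 ω, V 0 ω)) P P :=
  ⟨((hs.measurable_Z i).prodMk (hs.measurable_V i)).aemeasurable,
    ((hs.measurable_Z 0).prodMk (hs.measurable_V 0)).aemeasurable, hs.ident i⟩

/-- The localization `φ` of `f r` to a neighbourhood of `I` on which `f` is bounded has a vanishing
integrated squared bias. -/
theorem IsRegressionSample.exists_localization {Z : ℕ → Ω → 𝔼} {V : ℕ → Ω → ℝ}
    {f r : 𝔼 → ℝ} (hs : IsRegressionSample P Z V f r) {K : 𝔼 → ℝ} (hK : IsKernel K) {I : Set 𝔼}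
    (hI : IsCompact I) (f1 : DensityCondition f I) (G : Measure 𝔼) [IsFiniteMeasure G]
    (hGI : G Iᶜ = 0) (htame : IsTame P G I (Z 0) (V 0) r) {h : ℕ → ℝ} (hpos : ∀ n, 0 < h n)
    (h1 : Tendsto h atTop (𝓝 0)) {δ₁ : ℝ} (hδ₁ : 0 < δ₁) :
    ∃ δ > 0, δ ≤ δ₁ ∧ ∃ φ : 𝔼 → ℝ,
      Measurable φ ∧ (∀ y ∈ Metric.thickening δ I, φ y = f y * r y) ∧
      Tendsto (fun n => ∫⁻ z, oscillation K (h n) φ z ∂G) atTop (𝓝 0) := by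
  have hfm := hs.measurable_f
  have hrm := hs.measurable_r
  obtain ⟨B, hB, δ₂, hδ₂, hfB⟩ := f1.exists_bound hI
  rcases htame with hG | ⟨U, C', hU, hIU, hrC, hrcont, -⟩
  · have hφm : Measurable ((Metric.thickening (min δ₁ δ₂) I).indicator fun y => f y * r y) :=
      (hfm.mul hrm).indicator Metric.isOpen_thickening.measurableSet
    refine ⟨min δ₁ δ₂, lt_min hδ₁ hδ₂, min_le_left _ _, _, hφm,
      fun y hy => Set.indicator_of_mem hy _,
      hK.tendsto_lintegral_oscillation_of_hasBoundedDensity hpos h1 hφm ?_ G hG⟩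
    refine (memLp_two_iff_lintegral hφm.aestronglyMeasurable).2 ?_
    have hr2 := (memLp_two_iff_lintegral hs.memLp_r.1).1 hs.memLp_r
    rw [lintegral_comp_of_law (hs.measurable_Z 0) hfm (hs.law_Z 0)
      (F := fun y => ENNReal.ofReal (r y ^ 2)) (by fun_prop)] at hr2
    refine lt_of_le_of_lt ?_ (ENNReal.mul_lt_top (ENNReal.ofReal_lt_top (r := B)) hr2)
    rw [← lintegral_const_mul _ (by fun_prop)]
    refine lintegral_mono fun y => ?_
    by_cases hy : y ∈ Metric.thickening (min δ₁ δ₂) I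
    · obtain ⟨z, hz, hyz⟩ := Metric.mem_thickening_iff.1 hy
      rw [Set.indicator_of_mem hy, ← ENNReal.ofReal_mul (hs.f_nonneg y),
        ← ENNReal.ofReal_mul hB.le]
      refine ENNReal.ofReal_le_ofReal ?_
      have hfy := hfB z hz y (hyz.trans_le (min_le_right _ _))
      calc (f y * r y) ^ 2 = f y * (f y * r y ^ 2) := by ring
        _ ≤ B * (f y * r y ^ 2) := by
            gcongr
            exact mul_nonneg (hs.f_nonneg y) (sq_nonneg _)
    · rw [Set.indicator_of_notMem hy]; simp
  · obtain ⟨δ₃, hδ₃, hδU⟩ := hI.exists_thickening_subset_open hU hIU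
    set δ := min (min δ₁ δ₂) δ₃
    have hδ : 0 < δ := lt_min (lt_min hδ₁ hδ₂) hδ₃
    have hφm : Measurable ((Metric.thickening δ I).indicator fun y => f y * r y) :=
      (hfm.mul hrm).indicator Metric.isOpen_thickening.measurableSet
    refine ⟨δ, hδ, (min_le_left _ _).trans (min_le_left _ _), _, hφm,
      fun y hy => Set.indicator_of_mem hy _,
      hK.tendsto_lintegral_oscillation_of_bounded hpos h1 hφm (C := B * C') (fun y => ?_) G ?_⟩
    · by_cases hy : y ∈ Metric.thickening δ I
      · obtain ⟨z, hz, hyz⟩ := Metric.mem_thickening_iff.1 hy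
        rw [Set.indicator_of_mem hy, abs_mul, abs_of_nonneg (hs.f_nonneg y)]
        refine mul_le_mul
          (hfB z hz y (hyz.trans_le ((min_le_left _ _).trans (min_le_right _ _))))
          (hrC y (hδU (Metric.thickening_mono (min_le_right _ _) I hy))) (abs_nonneg _) hB.le
      · rw [Set.indicator_of_notMem hy, abs_zero]
        positivity
    · filter_upwards [hrcont, measure_eq_zero_iff_ae_notMem.1 hGI] with z hz hzI
      rw [Set.notMem_compl_iff] at hzI
      have hfz : ContinuousAt f z := by
        refine Metric.continuousAt_iff.2 fun e he => ?_
        obtain ⟨δ', hδ', h'⟩ := f1.1 e he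
        exact ⟨δ', hδ', fun y hy => h' z hzI y hy⟩
      refine (hfz.mul hz).congr ?_
      filter_upwards [Metric.isOpen_thickening.mem_nhds
        (Metric.self_subset_thickening hδ I hzI)] with y hy
      rw [Set.indicator_of_mem hy]
      rfl

/-- The integrated mean squared error of the numerator of the regression estimator vanishes. -/
theorem IsRegressionSample.tendsto_lintegral_numeratorEst [IsProbabilityMeasure P]
    {Z : ℕ → Ω → 𝔼} {V : ℕ → Ω → ℝ}
    {f r : 𝔼 → ℝ} (hs : IsRegressionSample P Z V f r) {K : 𝔼 → ℝ} (hK : IsKernel K) {I : Set 𝔼}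
    (hI : IsCompact I) (f1 : DensityCondition f I) (G : Measure 𝔼) [IsFiniteMeasure G]
    (hGI : G Iᶜ = 0) (htame : IsTame P G I (Z 0) (V 0) r) {h : ℕ → ℝ} (hpos : ∀ n, 0 < h n)
    (h1 : Tendsto h atTop (𝓝 0))
    (h2 : Tendsto (fun n : ℕ => (n : ℝ) * h n ^ (2 * d)) atTop atTop) :
    Tendsto (fun n => ∫⁻ ω, ∫⁻ z, ENNReal.ofReal
      ((numeratorEst K (h n) n (fun i => Z i ω) (fun i => V i ω) z - f z * r z) ^ 2) ∂G ∂P)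
      atTop (𝓝 0) := by
  have hfm := hs.measurable_f
  have hrm := hs.measurable_r
  obtain ⟨C, δ₁, hC, hδ₁, hvar⟩ := hs.exists_lintegral_sq_le hK hI f1 G hGI htame
  obtain ⟨B, hB, δ₂, hδ₂, hfB⟩ := f1.exists_bound hI
  obtain ⟨δ, hδ, hδ12, φ, hφ, hφeq, hosc⟩ :=
    hs.exists_localization hK hI f1 G hGI htame hpos h1 (lt_min hδ₁ hδ₂)
  have hvar0 : Tendsto (fun n : ℕ => C / ENNReal.ofReal ((n : ℝ) * h n ^ d)) atTop (𝓝 0) := by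
    have := ENNReal.Tendsto.const_div (a := C)
      (ENNReal.tendsto_ofReal_atTop.comp (tendsto_mul_pow_atTop hpos h1 h2)) (Or.inr hC.ne)
    rwa [ENNReal.div_top] at this
  have hlim : Tendsto (fun n : ℕ => C / ENNReal.ofReal ((n : ℝ) * h n ^ d) +
      ∫⁻ z, oscillation K (h n) φ z ∂G) atTop (𝓝 0) := by
    simpa using hvar0.add hosc
  refine tendsto_of_tendsto_of_tendsto_of_le_of_le' tendsto_const_nhds hlim
    (Eventually.of_forall fun _ => zero_le) ?_
  have hsm : Tendsto (fun n => √d * h n) atTop (𝓝 0) := by simpa using h1.const_mul √d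
  filter_upwards [hsm.eventually (gt_mem_nhds hδ), eventually_gt_atTop 0] with n hn hn0
  have hKm := hK.measurable_scaled (h n)
  have hn' : (0 : ℝ) < n := by exact_mod_cast hn0
  have hpt : ∀ᵐ z ∂G, ∫⁻ ω, ENNReal.ofReal
      ((numeratorEst K (h n) n (fun i => Z i ω) (fun i => V i ω) z - f z * r z) ^ 2) ∂P ≤
      (n : ℝ≥0∞)⁻¹ * ∫⁻ ω, ENNReal.ofReal ((scaled K (h n) (z - Z 0 ω) * V 0 ω) ^ 2) ∂P +
        oscillation K (h n) φ z := by
    filter_upwards [measure_eq_zero_iff_ae_notMem.1 hGI] with z hz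
    rw [Set.notMem_compl_iff] at hz
    have hmemS := hs.memLp_scaled hK (hpos n) (z := z) (B := B) fun y hy => hfB z hz y (by
      rw [← dist_eq_norm, dist_comm] at hy
      exact (hy.trans_lt hn).trans_le (hδ12.trans (min_le_right _ _)))
    have hZm := hs.measurable_Z
    have hVm := hs.measurable_V
    have hpair : Measurable fun p : 𝔼 × ℝ => scaled K (h n) (z - p.1) * p.2 := by fun_prop
    have hmean : ∫ ω, scaled K (h n) (z - Z 0 ω) * V 0 ω ∂P =
        ∫ y, φ y ∂kernelMeasure K (h n) z := by
      rw [hs.regression (fun y => scaled K (h n) (z - y)) (by fun_prop) hmemS,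
        integral_comp_of_law (hZm 0) hfm hs.f_nonneg (hs.law_Z 0)
          (F := fun y => scaled K (h n) (z - y) * r y) (by fun_prop),
        hK.integral_kernelMeasure (hpos n)]
      refine integral_congr_ae (ae_of_all _ fun y => ?_)
      by_cases h0 : scaled K (h n) (z - y) = 0
      · simp [h0]
      · have hy := hK.norm_le_of_scaled_ne_zero (hpos n) h0
        rw [← dist_eq_norm, dist_comm] at hy
        simp only
        rw [hφeq y (Metric.mem_thickening_iff.2 ⟨z, hz, hy.trans_lt hn⟩)]
        ring
    have hP := hK.isProbabilityMeasure_kernelMeasure (hpos n) z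
    rw [← hφeq z (Metric.self_subset_thickening hδ I hz)]
    have hξind : iIndepFun (fun i ω => scaled K (h n) (z - Z i ω) * V i ω) P :=
      hs.indep.comp (fun _ p => scaled K (h n) (z - p.1) * p.2) fun _ => hpair
    have hξid : ∀ i, IdentDistrib (fun ω => scaled K (h n) (z - Z i ω) * V i ω)
        (fun ω => scaled K (h n) (z - Z 0 ω) * V 0 ω) P P :=
      fun i => (hs.identDistrib i).comp hpair
    have hξint : Integrable (fun ω => scaled K (h n) (z - Z 0 ω) * V 0 ω) P :=
      hmemS.integrable_mul hs.memLp_V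
    refine (lintegral_sq_average_sub_le
      (fun i => by have := hZm i; have := hVm i; fun_prop) hξind hξid hξint _ hn0).trans ?_
    refine add_le_add le_rfl ?_
    rw [hmean]
    exact ofReal_sq_integral_sub_le _ hφ.aestronglyMeasurable _
  have hZm := hs.measurable_Z
  have hVm := hs.measurable_V
  have hswap : Measurable fun p : Ω × 𝔼 => ENNReal.ofReal
      ((numeratorEst K (h n) n (fun i => Z i p.1) (fun i => V i p.1) p.2 - f p.2 * r p.2) ^ 2) := by
    unfold numeratorEst
    fun_prop
  rw [lintegral_lintegral_swap hswap.aemeasurable]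
  refine (lintegral_mono_ae hpt).trans ?_
  rw [lintegral_add_right _ (hK.measurable_oscillation _ hφ), lintegral_const_mul _ (by
    refine Measurable.lintegral_prod_right' (f := fun p : 𝔼 × Ω =>
      ENNReal.ofReal ((scaled K (h n) (p.1 - Z 0 p.2) * V 0 p.2) ^ 2)) ?_
    fun_prop)]
  gcongr
  refine (mul_le_mul_right (hvar (h n) (hpos n)
    (hn.trans_le (hδ12.trans (min_le_left _ _)))) _).trans_eq ?_
  rw [ENNReal.ofReal_mul hn'.le, ENNReal.ofReal_natCast, div_eq_mul_inv, div_eq_mul_inv,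
    ENNReal.mul_inv (Or.inr ENNReal.ofReal_ne_top) (Or.inl (ENNReal.natCast_ne_top n))]
  ring

end Regression

section Consistency

variable {Ω : Type*} [MeasurableSpace Ω] {P : Measure Ω}

/-- The kernel regression estimator, with separate kernels and bandwidths in the numerator and in
the density estimator of the denominator. -/
noncomputable def regressionEst (K Ks : 𝔼 → ℝ) (h w : ℝ) (n : ℕ) (Zs : ℕ → 𝔼) (Vs : ℕ → ℝ)
    (z : 𝔼) : ℝ :=
  (∑ i ∈ Finset.range n, scaled K h (z - Zs i) * Vs i) / (n * densityEst Ks w n Zs z)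

theorem regressionEst_eq {K Ks : 𝔼 → ℝ} {h w : ℝ} {n : ℕ} (Zs : ℕ → 𝔼) (Vs : ℕ → ℝ) (z : 𝔼) :
    regressionEst K Ks h w n Zs Vs z = numeratorEst K h n Zs Vs z / densityEst Ks w n Zs z := by
  rw [regressionEst, numeratorEst, div_mul_eq_div_div, div_eq_inv_mul (∑ i ∈ _, _)]

/-- Consistency of the kernel regression estimator in `L²(G)`, in probability. -/
theorem IsRegressionSample.tendsto_measure_eLpNorm [IsProbabilityMeasure P]
    {Z : ℕ → Ω → 𝔼} {V : ℕ → Ω → ℝ}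
    {f r : 𝔼 → ℝ} (hs : IsRegressionSample P Z V f r) {K Ks : 𝔼 → ℝ} (hK : IsKernel K)
    (hKs : IsKernel Ks) {L : ℝ≥0} (hL : LipschitzWith L Ks) {I : Set 𝔼}
    (hI : IsCompact I) (f1 : DensityCondition f I) (G : Measure 𝔼) [IsFiniteMeasure G]
    (hGI : G Iᶜ = 0) (htame : IsTame P G I (Z 0) (V 0) r) (hrG : MemLp r 2 G)
    {h w : ℕ → ℝ} (hpos : ∀ n, 0 < h n) (h1 : Tendsto h atTop (𝓝 0))
    (h2 : Tendsto (fun n : ℕ => (n : ℝ) * h n ^ (2 * d)) atTop atTop)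
    (hw0 : ∀ᶠ n in atTop, 0 < w n) (hwt : Tendsto w atTop (𝓝 0))
    (hnw : ∀ᶠ n : ℕ in atTop, 1 ≤ n * w n ^ (d + 1)) {e : ℝ} (he : 0 < e) :
    Tendsto (fun n => P {ω | ENNReal.ofReal e ≤ eLpNorm (fun z => regressionEst K Ks (h n) (w n) n
      (fun i => Z i ω) (fun i => V i ω) z - r z) 2 G}) atTop (𝓝 0) := by
  obtain ⟨c, hc, hfc⟩ := f1.2
  have hfm := hs.measurable_f
  have hrm := hs.measurable_r
  have hZm := hs.measurable_Z
  have hVm := hs.measurable_V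
  set R : ℝ≥0∞ := ∫⁻ z, ENNReal.ofReal (r z ^ 2) ∂G
  have hR : R < ∞ := (memLp_two_iff_lintegral hrG.1).1 hrG
  -- on the event `A < τ`, `|densityEst - f| < e'` the squared error is below `e ^ 2`
  set τ : ℝ := c ^ 2 * e ^ 2 / 32
  have hτ : 0 < τ := by positivity
  obtain ⟨e', he'0, he'c, he'R⟩ : ∃ e' > 0, e' ≤ c / 2 ∧ e' ^ 2 * R.toReal ≤ τ := by
    refine ⟨min (c / 2) √(τ / (R.toReal + 1)), by positivity, min_le_left _ _, ?_⟩
    calc min (c / 2) √(τ / (R.toReal + 1)) ^ 2 * R.toReal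
        ≤ √(τ / (R.toReal + 1)) ^ 2 * (R.toReal + 1) := by
          gcongr
          · exact min_le_right _ _
          · linarith
      _ = τ := by
          rw [Real.sq_sqrt (by positivity)]
          field_simp
  set A : ℕ → Ω → ℝ≥0∞ := fun n ω => ∫⁻ z, ENNReal.ofReal
    ((numeratorEst K (h n) n (fun i => Z i ω) (fun i => V i ω) z - f z * r z) ^ 2) ∂G
  have hAm : ∀ n, Measurable (A n) := fun n => by
    have hKm := hK.measurable_scaled (h n)
    refine Measurable.lintegral_prod_right' (f := fun p : Ω × 𝔼 => ENNReal.ofReal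
      ((numeratorEst K (h n) n (fun i => Z i p.1) (fun i => V i p.1) p.2 - f p.2 * r p.2) ^ 2)) ?_
    unfold numeratorEst
    fun_prop
  have hAlim : Tendsto (fun n => P {ω | ENNReal.ofReal τ ≤ A n ω}) atTop (𝓝 0) := by
    have hdiv : Tendsto (fun n => (∫⁻ ω, A n ω ∂P) / ENNReal.ofReal τ) atTop (𝓝 0) := by
      have := ENNReal.Tendsto.div_const (b := ENNReal.ofReal τ)
        (hs.tendsto_lintegral_numeratorEst hK hI f1 G hGI htame hpos h1 h2)
        (Or.inr (by simpa using hτ))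
      rwa [ENNReal.zero_div] at this
    refine tendsto_of_tendsto_of_tendsto_of_le_of_le tendsto_const_nhds hdiv
      (fun _ => zero_le) fun n => ?_
    exact meas_ge_le_lintegral_div (hAm n).aemeasurable (by simpa using hτ) ENNReal.ofReal_ne_top
  have hZind : iIndepFun Z P := hs.indep.comp (fun _ p => p.1) fun _ => measurable_fst
  have hBlim := tendsto_measure_densityEst hKs hL hw0 hwt hnw hZm hZind hfm hs.f_nonneg hs.law_Z
    hI f1 he'0
  have hsum := hAlim.add hBlim
  rw [add_zero] at hsum
  refine tendsto_of_tendsto_of_tendsto_of_le_of_le tendsto_const_nhds hsum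
    (fun _ => zero_le) fun n => ?_
  refine (measure_mono fun ω hω => ?_).trans (measure_union_le _ _)
  by_contra hcon
  simp only [Set.mem_union, Set.mem_ofPred_eq, not_or, not_le, not_exists, not_and] at hcon hω
  obtain ⟨hA, hB⟩ := hcon
  set N := numeratorEst K (h n) n (fun i => Z i ω) (fun i => V i ω)
  set F := densityEst Ks (w n) n (fun i => Z i ω)
  have hpt : ∀ᵐ z ∂G, ENNReal.ofReal ((regressionEst K Ks (h n) (w n) n
      (fun i => Z i ω) (fun i => V i ω) z - r z) ^ 2) ≤
      ENNReal.ofReal (8 / c ^ 2) * (ENNReal.ofReal ((N z - f z * r z) ^ 2) +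
        ENNReal.ofReal (e' ^ 2) * ENNReal.ofReal (r z ^ 2)) := by
    filter_upwards [measure_eq_zero_iff_ae_notMem.1 hGI] with z hz
    rw [Set.notMem_compl_iff] at hz
    have hBz := abs_lt.1 (hB z hz)
    have hfz := hfc z hz
    have hF : c / 2 ≤ F z := by linarith
    have hF0 : 0 < F z := by linarith
    rw [regressionEst_eq, ← ENNReal.ofReal_mul (sq_nonneg _), ← ENNReal.ofReal_add (sq_nonneg _)
      (by positivity), ← ENNReal.ofReal_mul (by positivity)]
    refine ENNReal.ofReal_le_ofReal ?_
    have hid : N z / F z - r z = ((N z - f z * r z) + r z * (f z - F z)) / F z := by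
      field_simp; ring
    rw [hid, div_pow, div_le_iff₀ (by positivity)]
    have hsq : (f z - F z) ^ 2 ≤ e' ^ 2 := sq_le_sq' (by linarith) (by linarith)
    have hF2 : c ^ 2 / 4 ≤ F z ^ 2 := by nlinarith
    calc ((N z - f z * r z) + r z * (f z - F z)) ^ 2
        ≤ 2 * ((N z - f z * r z) ^ 2 + r z ^ 2 * (f z - F z) ^ 2) := by
          nlinarith [sq_nonneg ((N z - f z * r z) - r z * (f z - F z))]
      _ ≤ 2 * ((N z - f z * r z) ^ 2 + r z ^ 2 * e' ^ 2) := by gcongr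
      _ = 8 / c ^ 2 * ((N z - f z * r z) ^ 2 + e' ^ 2 * r z ^ 2) * (c ^ 2 / 4) := by
          field_simp; ring
      _ ≤ _ := by gcongr
  have hlt : ∫⁻ z, ENNReal.ofReal ((regressionEst K Ks (h n) (w n) n
      (fun i => Z i ω) (fun i => V i ω) z - r z) ^ 2) ∂G < ENNReal.ofReal (e ^ 2) := by
    refine (lintegral_mono_ae hpt).trans_lt ?_
    rw [lintegral_const_mul' _ _ ENNReal.ofReal_ne_top, lintegral_add_right _ (by fun_prop),
      lintegral_const_mul' _ _ ENNReal.ofReal_ne_top]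
    change ENNReal.ofReal (8 / c ^ 2) * (A n ω + ENNReal.ofReal (e' ^ 2) * R) < _
    have h3 : ENNReal.ofReal (e' ^ 2) * R ≤ ENNReal.ofReal τ := by
      rw [← ENNReal.ofReal_toReal hR.ne, ← ENNReal.ofReal_mul (sq_nonneg _)]
      exact ENNReal.ofReal_le_ofReal he'R
    calc ENNReal.ofReal (8 / c ^ 2) * (A n ω + ENNReal.ofReal (e' ^ 2) * R)
        ≤ ENNReal.ofReal (8 / c ^ 2) * (ENNReal.ofReal τ + ENNReal.ofReal τ) := by gcongr
      _ = ENNReal.ofReal (e ^ 2 / 2) := by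
          rw [← ENNReal.ofReal_add hτ.le hτ.le, ← ENNReal.ofReal_mul (by positivity)]
          congr 1
          simp only [τ]
          field_simp; ring
      _ < ENNReal.ofReal (e ^ 2) := by
          rw [ENNReal.ofReal_lt_ofReal_iff (by positivity)]
          have : 0 < e ^ 2 := by positivity
          linarith
  rw [lintegral_ofReal_sq_eq, ENNReal.ofReal_pow he.le] at hlt
  exact absurd (pow_le_pow_left' hω 2) hlt.not_ge

end Consistency

/-! ### Minimum distance estimators -/

section Argmin

variable {Ω : Type*} [MeasurableSpace Ω] {P : Measure Ω} {q : ℕ}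

theorem tendstoInMeasure_of_dist {P : Measure Ω} {E : Type*} [PseudoMetricSpace E]
    {θs : ℕ → Ω → E} {θT : E}
    (h : ∀ r > 0, Tendsto (fun n => P {ω | r ≤ dist (θs n ω) θT}) atTop (𝓝 0)) :
    TendstoInMeasure P θs atTop fun _ => θT :=
  tendstoInMeasure_iff_dist.2 h

theorem eLpNorm_le_restrict_add_compl {α : Type*} [MeasurableSpace α] {μ : Measure α} {f : α → ℝ}
    (hf : AEStronglyMeasurable f μ) {S : Set α} (hS : MeasurableSet S) :
    eLpNorm f 2 μ ≤ eLpNorm f 2 (μ.restrict S) + eLpNorm f 2 (μ.restrict Sᶜ) := by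
  rw [← eLpNorm_indicator_eq_eLpNorm_restrict hS,
    ← eLpNorm_indicator_eq_eLpNorm_restrict hS.compl]
  calc eLpNorm f 2 μ = eLpNorm (S.indicator f + Sᶜ.indicator f) 2 μ := by
        rw [Set.indicator_self_add_compl]
    _ ≤ _ := eLpNorm_add_le (hf.indicator hS) (hf.indicator hS.compl) (by norm_num)

theorem exists_eLpNorm_restrict_compl_le {α : Type*} [MeasurableSpace α] {μ : Measure α}
    {g : α → ℝ} (hg : MemLp g 2 μ) {S : ℕ → Set α} (hS : ∀ k, MeasurableSet (S k))
    (hSae : ∀ᵐ z ∂μ, ∀ᶠ k in atTop, z ∈ S k) {e : ℝ} (he : 0 < e) :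
    ∃ k, eLpNorm g 2 (μ.restrict (S k)ᶜ) ≤ ENNReal.ofReal e := by
  have hlim : Tendsto (fun k => ∫⁻ z, (S k)ᶜ.indicator (fun z => ENNReal.ofReal (g z ^ 2)) z ∂μ)
      atTop (𝓝 (∫⁻ _z, 0 ∂μ)) := by
    refine tendsto_lintegral_of_dominated_convergence' (fun z => ENNReal.ofReal (g z ^ 2))
      (fun k => ?_) (fun k => ae_of_all _ fun z => Set.indicator_le_self _ _ z)
      ((memLp_two_iff_lintegral hg.1).1 hg).ne ?_
    · exact (hg.1.aemeasurable.pow_const 2).ennreal_ofReal.indicator (hS k).compl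
    · filter_upwards [hSae] with z hz
      refine tendsto_const_nhds.congr' ?_
      filter_upwards [hz] with k hk
      rw [Set.indicator_of_notMem (Set.notMem_compl_iff.2 hk)]
  rw [lintegral_zero] at hlim
  obtain ⟨k, hk⟩ := (hlim.eventually (ge_mem_nhds
    (show (0 : ℝ≥0∞) < ENNReal.ofReal (e ^ 2) by simpa using by positivity))).exists
  refine ⟨k, ?_⟩
  rw [lintegral_indicator (hS k).compl, lintegral_ofReal_sq_eq, ENNReal.ofReal_pow he.le] at hk
  by_contra hcon
  exact absurd hk (ENNReal.pow_lt_pow_left two_ne_zero (not_le.1 hcon)).not_ge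

theorem eLpNorm_two_le_of_ae_abs_le {α : Type*} [MeasurableSpace α] {μ : Measure α} {f : α → ℝ}
    {c : ℝ} (hf : ∀ᵐ z ∂μ, |f z| ≤ c) :
    eLpNorm f 2 μ ≤ μ Set.univ ^ (2⁻¹ : ℝ) * ENNReal.ofReal c := by
  simpa using eLpNorm_le_of_ae_bound (p := 2) (μ := μ) (f := f) hf

/-- Consistency of minimum distance estimators. The criterion `‖D θ‖` has to be close to the
distance `‖H - F θ‖` in `L²(G)` at the true minimizer, but uniformly in `θ` only after restriction
to sets `S k` which exhaust the space; restriction can only decrease the criterion, so this still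
bounds it from below away from the minimizer. -/
theorem tendstoInMeasure_argmin {Θ : Set (EuclideanSpace ℝ (Fin q))} (hΘ : IsCompact Θ)
    (G : Measure 𝔼) [IsFiniteMeasure G] {H : 𝔼 → ℝ} (hH : MemLp H 2 G)
    {F : EuclideanSpace ℝ (Fin q) → 𝔼 → ℝ} (hF : ∀ θ ∈ Θ, MemLp (F θ) 2 G)
    {C β : ℝ} (hC : 0 ≤ C) (hβ : 0 < β)
    (hHol : ∀ θ₁ ∈ Θ, ∀ θ₂ ∈ Θ, ∀ᵐ z ∂G, |F θ₂ z - F θ₁ z| ≤ ‖θ₂ - θ₁‖ ^ β * C)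
    {θT : EuclideanSpace ℝ (Fin q)} (hθT : θT ∈ Θ)
    (huniq : ∀ θ ∈ Θ, θ ≠ θT → rho G H (F θT) < rho G H (F θ))
    {D : ℕ → Ω → EuclideanSpace ℝ (Fin q) → 𝔼 → ℝ}
    (hD : ∀ n ω, ∀ θ ∈ Θ, AEStronglyMeasurable (D n ω θ) G)
    {S : ℕ → Set 𝔼} (hS : ∀ k, MeasurableSet (S k)) (hSae : ∀ᵐ z ∂G, ∀ᶠ k in atTop, z ∈ S k)
    (hupper : ∀ e : ℝ, 0 < e → Tendsto (fun n => P {ω | ENNReal.ofReal e ≤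
      eLpNorm (fun z => D n ω θT z - (H z - F θT z)) 2 G}) atTop (𝓝 0))
    (hlower : ∀ k, ∀ e : ℝ, 0 < e → Tendsto (fun n => P {ω | ∃ θ ∈ Θ, ENNReal.ofReal e ≤
      eLpNorm (fun z => D n ω θ z - (H z - F θ z)) 2 (G.restrict (S k))}) atTop (𝓝 0))
    {θs : ℕ → Ω → EuclideanSpace ℝ (Fin q)}
    (hθs : ∀ᶠ n in atTop, ∀ᵐ ω ∂P, IsArgmin Θ (fun θ => eLpNorm (D n ω θ) 2 G ^ 2) (θs n ω)) :
    TendstoInMeasure P θs atTop fun _ => θT := by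
  refine tendstoInMeasure_of_dist fun r hr => ?_
  set A : EuclideanSpace ℝ (Fin q) → ℝ≥0∞ := fun θ => eLpNorm (fun z => H z - F θ z) 2 G
  have hAL : ∀ θ ∈ Θ, MemLp (fun z => H z - F θ z) 2 G := fun θ hθ => hH.sub (hF θ hθ)
  have hAtop : ∀ θ ∈ Θ, A θ ≠ ∞ := fun θ hθ => (hAL θ hθ).2.ne
  set mG : ℝ≥0∞ := G Set.univ ^ (2⁻¹ : ℝ)
  have hmG : mG ≠ ∞ := ENNReal.rpow_ne_top_of_nonneg (by norm_num) (measure_ne_top _ _)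
  have hAlip : ∀ θ₁ ∈ Θ, ∀ θ₂ ∈ Θ, A θ₁ ≤ A θ₂ + ENNReal.ofReal (‖θ₂ - θ₁‖ ^ β * C) * mG := by
    intro θ₁ h₁ θ₂ h₂
    have hbd : eLpNorm (fun z => F θ₂ z - F θ₁ z) 2 G ≤ mG * ENNReal.ofReal (‖θ₂ - θ₁‖ ^ β * C) :=
      eLpNorm_two_le_of_ae_abs_le (hHol θ₁ h₁ θ₂ h₂)
    calc A θ₁ = eLpNorm ((fun z => H z - F θ₂ z) + fun z => F θ₂ z - F θ₁ z) 2 G :=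
          congrArg (eLpNorm · 2 G) (by ext z; simp)
      _ ≤ A θ₂ + eLpNorm (fun z => F θ₂ z - F θ₁ z) 2 G :=
          eLpNorm_add_le (hAL _ h₂).1 ((hF _ h₂).1.sub (hF _ h₁).1) (by norm_num)
      _ ≤ _ := by rw [mul_comm] at hbd; gcongr
  set Θr := Θ ∩ {θ | r ≤ dist θ θT}
  have hΘr : IsCompact Θr :=
    hΘ.inter_right (isClosed_le continuous_const (continuous_id.dist continuous_const))
  rcases Θr.eq_empty_or_nonempty with hemp | hne
  · refine tendsto_const_nhds.congr' ?_
    filter_upwards [hθs] with n hn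
    refine (measure_eq_zero_iff_ae_notMem.2 ?_).symm
    filter_upwards [hn] with ω hω hr'
    have hmem : θs n ω ∈ Θr := ⟨hω.1, hr'⟩
    rw [hemp] at hmem
    exact hmem
  have hlsc : LowerSemicontinuousOn A Θr := by
    intro θ hθ y hy
    have hcont : Tendsto (fun θ' => ENNReal.ofReal (‖θ' - θ‖ ^ β * C) * mG) (𝓝[Θr] θ) (𝓝 0) := by
      have h1 : Tendsto (fun θ' => ‖θ' - θ‖ ^ β * C) (𝓝[Θr] θ) (𝓝 0) := by
        have h2 : Tendsto (fun θ' => ‖θ' - θ‖) (𝓝[Θr] θ) (𝓝 0) :=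
          (tendsto_norm_sub_self θ).mono_left nhdsWithin_le_nhds
        have h3 := (h2.rpow_const (p := β) (Or.inr hβ.le)).mul_const C
        rwa [Real.zero_rpow hβ.ne', zero_mul] at h3
      have := ENNReal.Tendsto.mul_const (b := mG) (ENNReal.tendsto_ofReal h1) (Or.inr hmG)
      simpa using this
    have hgap : 0 < A θ - y := tsub_pos_of_lt hy
    filter_upwards [hcont.eventually (gt_mem_nhds hgap), self_mem_nhdsWithin] with θ' h1 h2
    have h3 := hAlip θ hθ.1 θ' h2.1
    by_contra hle
    have h4 : A θ < y + (A θ - y) := h3.trans_lt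
      (ENNReal.add_lt_add_of_le_of_lt ((not_lt.1 hle).trans_lt hy.lt_top).ne (not_lt.1 hle) h1)
    rw [add_tsub_cancel_of_le hy.le] at h4
    exact lt_irrefl _ h4
  obtain ⟨θ', hθ', hmin⟩ := hlsc.exists_isMinOn hne hΘr
  have hne' : θ' ≠ θT := fun h0 => by
    have : r ≤ dist θ' θT := hθ'.2
    rw [h0, dist_self] at this
    exact hr.not_ge this
  have hAlt : A θT < A θ' := by
    have := huniq θ' hθ'.1 hne'
    simp only [rho, lintegral_ofReal_sq_eq] at this
    by_contra hcon
    exact absurd this (pow_le_pow_left' (not_lt.1 hcon) 2).not_gt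
  -- the gap between the distance at `θT` and the distances outside the ball of radius `r`
  set γ : ℝ := (A θ').toReal - (A θT).toReal
  have hγ : 0 < γ := sub_pos.2 ((ENNReal.toReal_lt_toReal (hAtop _ hθT) (hAtop _ hθ'.1)).2 hAlt)
  -- an envelope of all `H - F θ`
  obtain ⟨ρ, hρpos, hρ⟩ := hΘ.isBounded.exists_pos_norm_le
  set g : 𝔼 → ℝ := fun z => |H z - F θT z| + (2 * ρ) ^ β * C
  have hg : MemLp g 2 G := (hAL _ hθT).abs.add (memLp_const _)
  obtain ⟨k, hk⟩ := exists_eLpNorm_restrict_compl_le hg hS hSae (show 0 < γ / 4 by positivity)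
  have htail : ∀ θ ∈ Θ, eLpNorm (fun z => H z - F θ z) 2 (G.restrict (S k)ᶜ) ≤
      ENNReal.ofReal (γ / 4) := fun θ hθ => by
    refine (eLpNorm_mono_ae_real ?_).trans hk
    filter_upwards [ae_restrict_of_ae (hHol θ hθ θT hθT)] with z hz
    rw [Real.norm_eq_abs]
    have h1 : ‖θT - θ‖ ≤ 2 * ρ := (norm_sub_le _ _).trans (by linarith [hρ _ hθT, hρ _ hθ])
    calc |H z - F θ z| = |(H z - F θT z) + (F θT z - F θ z)| := by ring_nf
      _ ≤ |H z - F θT z| + |F θT z - F θ z| := abs_add_le _ _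
      _ ≤ |H z - F θT z| + ‖θT - θ‖ ^ β * C := by gcongr
      _ ≤ g z := by simp only [g]; gcongr
  have hsum := (hupper (γ / 8) (by positivity)).add (hlower k (γ / 8) (by positivity))
  rw [add_zero] at hsum
  refine tendsto_of_tendsto_of_tendsto_of_le_of_le' tendsto_const_nhds hsum
    (Eventually.of_forall fun _ => zero_le) ?_
  filter_upwards [hθs] with n hn
  refine le_trans (measure_mono_ae ?_) (measure_union_le _ _)
  filter_upwards [hn] with ω hω hr'
  by_contra hcon
  obtain ⟨hup, hlo⟩ := not_or.1 hcon
  have hup : eLpNorm (fun z => D n ω θT z - (H z - F θT z)) 2 G < ENNReal.ofReal (γ / 8) :=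
    not_le.1 hup
  have hlo : ∀ θ ∈ Θ, eLpNorm (fun z => D n ω θ z - (H z - F θ z)) 2 (G.restrict (S k)) <
      ENNReal.ofReal (γ / 8) := fun θ hθ => not_le.1 fun h0 => hlo ⟨θ, hθ, h0⟩
  have hle : eLpNorm (D n ω (θs n ω)) 2 G ≤ eLpNorm (D n ω θT) 2 G := by
    by_contra h0
    exact absurd (hω.2 θT hθT) (ENNReal.pow_lt_pow_left two_ne_zero (not_le.1 h0)).not_ge
  set θ := θs n ω
  have hθ : θ ∈ Θ := hω.1
  have h1 : eLpNorm (fun z => H z - F θ z) 2 (G.restrict (S k)) ≤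
      eLpNorm (D n ω θ) 2 G + ENNReal.ofReal (γ / 8) := by
    calc eLpNorm (fun z => H z - F θ z) 2 (G.restrict (S k))
        = eLpNorm (D n ω θ - fun z => D n ω θ z - (H z - F θ z)) 2 (G.restrict (S k)) :=
          congrArg (eLpNorm · 2 (G.restrict (S k))) (by ext z; simp)
      _ ≤ eLpNorm (D n ω θ) 2 (G.restrict (S k)) +
          eLpNorm (fun z => D n ω θ z - (H z - F θ z)) 2 (G.restrict (S k)) :=
          eLpNorm_sub_le (hD n ω θ hθ).restrict ((hD n ω θ hθ).sub (hAL θ hθ).1).restrict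
            (by norm_num)
      _ ≤ _ := add_le_add (eLpNorm_mono_measure _ Measure.restrict_le_self) (hlo θ hθ).le
  have h2 : eLpNorm (D n ω θT) 2 G ≤ A θT + ENNReal.ofReal (γ / 8) := by
    calc eLpNorm (D n ω θT) 2 G
        = eLpNorm ((fun z => H z - F θT z) + fun z => D n ω θT z - (H z - F θT z)) 2 G :=
          congrArg (eLpNorm · 2 G) (by ext z; simp)
      _ ≤ A θT + eLpNorm (fun z => D n ω θT z - (H z - F θT z)) 2 G :=
          eLpNorm_add_le (hAL _ hθT).1 ((hD n ω θT hθT).sub (hAL _ hθT).1) (by norm_num)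
      _ ≤ _ := by gcongr
  have h3 : A θ' ≤ A θT + ENNReal.ofReal (γ / 8) + ENNReal.ofReal (γ / 8) +
      ENNReal.ofReal (γ / 4) := by
    calc A θ' ≤ A θ := hmin ⟨hθ, hr'⟩
      _ ≤ _ := eLpNorm_le_restrict_add_compl (hAL θ hθ).1 (hS k)
      _ ≤ _ := by
          refine add_le_add (h1.trans ?_) (htail θ hθ)
          gcongr
          exact hle.trans h2
  rw [← ENNReal.ofReal_toReal (hAtop _ hθT), ← ENNReal.ofReal_toReal (hAtop _ hθ'.1),
    ← ENNReal.ofReal_add (by positivity) (by positivity),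
    ← ENNReal.ofReal_add (by positivity) (by positivity),
    ← ENNReal.ofReal_add (by positivity) (by positivity),
    ENNReal.ofReal_le_ofReal_iff (by positivity)] at h3
  simp only [γ] at h3 hγ
  linarith

end Argmin

/-! ### The Berkson model -/

section Model

/-- Up to reflection `condMean fη r` is the convolution of a bounded and an integrable function. The
proof approximates `fη` in `L¹` by continuous functions with compact support. -/
theorem continuous_condMean {fη : 𝔼 → ℝ} (hfη : Integrable fη) {r : 𝔼 → ℝ}
    (hr : Measurable r) {C : ℝ} (hC : ∀ x, |r x| ≤ C) : Continuous (condMean fη r) := by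
  have hC0 : 0 ≤ C := (abs_nonneg _).trans (hC 0)
  have hrz : ∀ z, AEStronglyMeasurable (fun u => r (z + u)) volume := fun z =>
    (hr.comp (measurable_const_add z)).aestronglyMeasurable
  have hbd : ∀ z, ∀ᵐ u, ‖r (z + u)‖ ≤ C := fun z => ae_of_all _ fun u => hC _
  refine continuous_of_uniform_approx_of_continuous fun s hs => ?_
  obtain ⟨e, he, hes⟩ := Metric.mem_uniformity_dist.1 hs
  obtain ⟨ψ, hψc, hψ, hψcont, hψint⟩ :=
    hfη.exists_hasCompactSupport_integral_sub_le (ε := e / (2 * (C + 1))) (by positivity)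
  refine ⟨fun z => ∫ u, r (z + u) * ψ u, ?_, fun z => hes ?_⟩
  · have hloc : LocallyIntegrable r volume := fun x => by
      refine ⟨Metric.closedBall x 1, Metric.closedBall_mem_nhds x one_pos, ?_⟩
      exact Measure.integrableOn_of_bounded (M := C) measure_closedBall_lt_top.ne
        hr.aestronglyMeasurable (ae_of_all _ fun u => hC _)
    have hneg : HasCompactSupport fun u => ψ (-u) := hψc.comp_homeomorph (Homeomorph.neg _)
    have := hneg.continuous_convolution_right (ContinuousLinearMap.mul ℝ ℝ) hloc
      (hψcont.comp continuous_neg)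
    convert this using 1
    ext z
    rw [MeasureTheory.convolution_def]
    simp only [ContinuousLinearMap.mul_apply', neg_sub]
    rw [← integral_add_left_eq_self (fun t => r t * ψ (t - z)) z]
    simp
  · have h1 : Integrable fun u => r (z + u) * fη u := hfη.bdd_mul (hrz z) (hbd z)
    have h2 : Integrable fun u => r (z + u) * ψ u := hψint.bdd_mul (hrz z) (hbd z)
    rw [Real.dist_eq]
    change |(∫ u, r (z + u) * fη u) - ∫ u, r (z + u) * ψ u| < e
    rw [← integral_sub h1 h2]
    calc |∫ u, (r (z + u) * fη u - r (z + u) * ψ u)|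
        ≤ ∫ u, |r (z + u) * fη u - r (z + u) * ψ u| := abs_integral_le_integral_abs
      _ ≤ ∫ u, C * ‖fη u - ψ u‖ := by
          refine integral_mono (h1.sub h2).abs ((hfη.sub hψint).norm.const_mul C) fun u => ?_
          simp only
          rw [← mul_sub, abs_mul, Real.norm_eq_abs]
          exact mul_le_mul_of_nonneg_right (hC _) (abs_nonneg _)
      _ = C * ∫ u, ‖fη u - ψ u‖ := integral_const_mul _ _
      _ ≤ C * (e / (2 * (C + 1))) := by gcongr
      _ < e := by
          rw [mul_div_assoc', div_lt_iff₀ (by positivity)]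
          nlinarith

variable {Ω : Type*} [MeasurableSpace Ω] {P : Measure Ω}
  {Z η : ℕ → Ω → EuclideanSpace ℝ (Fin d)} {ε : ℕ → Ω → ℝ}
  {fZ fη : EuclideanSpace ℝ (Fin d) → ℝ}

theorem IsBerksonDesign.condMean_eq (hdes : IsBerksonDesign P Z η ε fZ fη) (r : 𝔼 → ℝ) (z : 𝔼) :
    condMean fη r z = ∫ u, r (z + u) ∂P.map (η 0) := by
  have := hdes.measurable_fη
  rw [hdes.law_η 0, integral_withDensity_eq_integral_toReal_smul (by fun_prop)
    (ae_of_all _ fun _ => ENNReal.ofReal_lt_top)]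
  simp_rw [ENNReal.toReal_ofReal (hdes.fη_nonneg _), smul_eq_mul, mul_comm (fη _)]
  rfl

theorem IsBerksonDesign.condVar_eq (hdes : IsBerksonDesign P Z η ε fZ fη) (r : 𝔼 → ℝ) (z : 𝔼) :
    condVar fη r z = ∫ u, (r (z + u) - condMean fη r z) ^ 2 ∂P.map (η 0) := by
  have := hdes.measurable_fη
  rw [hdes.law_η 0, integral_withDensity_eq_integral_toReal_smul (by fun_prop)
    (ae_of_all _ fun _ => ENNReal.ofReal_lt_top)]
  simp_rw [ENNReal.toReal_ofReal (hdes.fη_nonneg _), smul_eq_mul, mul_comm (fη _)]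
  rfl

variable [IsProbabilityMeasure P]

theorem IsBerksonDesign.isProbabilityMeasure_η (hdes : IsBerksonDesign P Z η ε fZ fη) :
    IsProbabilityMeasure (P.map (η 0)) :=
  Measure.isProbabilityMeasure_map (hdes.measurable_η 0).aemeasurable

theorem IsBerksonDesign.integrable_fη (hdes : IsBerksonDesign P Z η ε fZ fη) :
    Integrable fη := by
  have hP := hdes.isProbabilityMeasure_η
  have h1 : ∫⁻ u, ENNReal.ofReal (fη u) = 1 := by
    have := hP.measure_univ
    rwa [hdes.law_η 0, withDensity_apply _ MeasurableSet.univ, Measure.restrict_univ] at this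
  refine ⟨hdes.measurable_fη.aestronglyMeasurable, ?_⟩
  rw [hasFiniteIntegral_iff_ofReal (ae_of_all _ hdes.fη_nonneg), h1]
  exact ENNReal.one_lt_top

theorem measurable_condMean (hfη : Measurable fη) {r : 𝔼 → ℝ} (hr : Measurable r) :
    Measurable (condMean fη r) := by
  have : Measurable fun p : 𝔼 × 𝔼 => r (p.1 + p.2) * fη p.2 := by fun_prop
  exact (this.stronglyMeasurable.integral_prod_right (ν := volume)).measurable

theorem IsBerksonDesign.abs_condMean_le (hdes : IsBerksonDesign P Z η ε fZ fη) {r : 𝔼 → ℝ} {C : ℝ}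
    (hC : ∀ x, |r x| ≤ C) (z : 𝔼) : |condMean fη r z| ≤ C := by
  have := hdes.isProbabilityMeasure_η
  rw [hdes.condMean_eq, ← Real.norm_eq_abs]
  simpa using norm_integral_le_of_norm_le_const (μ := P.map (η 0)) (C := C)
    (f := fun u => r (z + u)) (ae_of_all _ fun u => hC (z + u))

theorem IsBerksonDesign.map_Z_η (hdes : IsBerksonDesign P Z η ε fZ fη) :
    P.map (fun ω => (Z 0 ω, η 0 ω)) = (P.map (Z 0)).prod (P.map (η 0)) := by
  have hZ := hdes.measurable_Z 0
  have hη := hdes.measurable_η 0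
  have hε := hdes.measurable_ε 0
  have := Measure.isProbabilityMeasure_map (μ := P) hZ.aemeasurable
  have := hdes.isProbabilityMeasure_η
  have := Measure.isProbabilityMeasure_map (μ := P) hε.aemeasurable
  have h1 : P.map (fun ω => (Z 0 ω, η 0 ω)) =
      (P.map fun ω => (Z 0 ω, η 0 ω, ε 0 ω)).map (Prod.map id Prod.fst) := by
    rw [Measure.map_map (by fun_prop) (by fun_prop)]
    rfl
  rw [h1, hdes.indep_triple 0, ← Measure.map_prod_map _ _ measurable_id measurable_fst,
    Measure.map_id, Measure.map_fst_prod, measure_univ, one_smul]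

theorem IsBerksonDesign.indepFun_Z_ε (hdes : IsBerksonDesign P Z η ε fZ fη) :
    IndepFun (Z 0) (ε 0) P := by
  have hZ := hdes.measurable_Z 0
  have hη := hdes.measurable_η 0
  have hε := hdes.measurable_ε 0
  have := Measure.isProbabilityMeasure_map (μ := P) hZ.aemeasurable
  have := hdes.isProbabilityMeasure_η
  have := Measure.isProbabilityMeasure_map (μ := P) hε.aemeasurable
  have h1 : P.map (fun ω => (Z 0 ω, ε 0 ω)) =
      (P.map fun ω => (Z 0 ω, η 0 ω, ε 0 ω)).map (Prod.map id Prod.snd) := by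
    rw [Measure.map_map (by fun_prop) (by fun_prop)]
    rfl
  rw [indepFun_iff_map_prod_eq_prod_map_map hZ.aemeasurable hε.aemeasurable, h1,
    hdes.indep_triple 0, ← Measure.map_prod_map _ _ measurable_id measurable_snd,
    Measure.map_id, Measure.map_snd_prod, measure_univ, one_smul]

theorem IsBerksonDesign.lintegral_Z_η (hdes : IsBerksonDesign P Z η ε fZ fη)
    {F : 𝔼 → 𝔼 → ℝ≥0∞} (hF : Measurable fun p : 𝔼 × 𝔼 => F p.1 p.2) :
    ∫⁻ ω, F (Z 0 ω) (η 0 ω) ∂P = ∫⁻ z, ∫⁻ u, F z u ∂P.map (η 0) ∂P.map (Z 0) := by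
  have hZ := hdes.measurable_Z 0
  have hη := hdes.measurable_η 0
  have := hdes.isProbabilityMeasure_η
  rw [← lintegral_prod (fun p => F p.1 p.2) hF.aemeasurable, ← hdes.map_Z_η,
    lintegral_map hF (by fun_prop)]

/-- Jensen's inequality for the conditional mean. -/
theorem IsBerksonDesign.memLp_condMean (hdes : IsBerksonDesign P Z η ε fZ fη) {r : 𝔼 → ℝ}
    (hr : Measurable r) (hr2 : MemLp (fun ω => r (Z 0 ω + η 0 ω)) 2 P) :
    MemLp (fun ω => condMean fη r (Z 0 ω)) 2 P := by
  have hZ := hdes.measurable_Z 0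
  have hprob := hdes.isProbabilityMeasure_η
  have hcm := measurable_condMean hdes.measurable_fη hr
  have hcmZ : Measurable fun ω => condMean fη r (Z 0 ω) := hcm.comp hZ
  refine (memLp_two_iff_lintegral hcmZ.aestronglyMeasurable).2 ?_
  have h2 := (memLp_two_iff_lintegral hr2.1).1 hr2
  rw [hdes.lintegral_Z_η (F := fun z u => ENNReal.ofReal (r (z + u) ^ 2)) (by fun_prop)] at h2
  refine lt_of_le_of_lt ?_ h2
  rw [← lintegral_map (f := fun z => ENNReal.ofReal (condMean fη r z ^ 2)) (by fun_prop) hZ]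
  refine lintegral_mono fun z => ?_
  simp only
  rw [hdes.condMean_eq]
  exact ofReal_sq_integral_le _ _

theorem IsBerksonDesign.integral_mul_condMean (hdes : IsBerksonDesign P Z η ε fZ fη) {r : 𝔼 → ℝ}
    (hr : Measurable r) (hr2 : MemLp (fun ω => r (Z 0 ω + η 0 ω)) 2 P) {ψ : 𝔼 → ℝ}
    (hψ : Measurable ψ) (hψ2 : MemLp (fun ω => ψ (Z 0 ω)) 2 P) :
    ∫ ω, ψ (Z 0 ω) * r (Z 0 ω + η 0 ω) ∂P = ∫ ω, ψ (Z 0 ω) * condMean fη r (Z 0 ω) ∂P := by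
  have hZ := hdes.measurable_Z 0
  have hη := hdes.measurable_η 0
  have hprob := hdes.isProbabilityMeasure_η
  have hcm := measurable_condMean hdes.measurable_fη hr
  have hm : Measurable fun p : 𝔼 × 𝔼 => ψ p.1 * r (p.1 + p.2) := by fun_prop
  have hpair : Measurable fun ω => (Z 0 ω, η 0 ω) := by fun_prop
  have hint : Integrable (fun p : 𝔼 × 𝔼 => ψ p.1 * r (p.1 + p.2))
      ((P.map (Z 0)).prod (P.map (η 0))) := by
    rw [← hdes.map_Z_η, integrable_map_measure hm.aestronglyMeasurable hpair.aemeasurable]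
    exact hψ2.integrable_mul hr2
  calc ∫ ω, ψ (Z 0 ω) * r (Z 0 ω + η 0 ω) ∂P
      = ∫ p, ψ p.1 * r (p.1 + p.2) ∂P.map (fun ω => (Z 0 ω, η 0 ω)) :=
        (integral_map hpair.aemeasurable hm.aestronglyMeasurable).symm
    _ = ∫ z, ψ z * condMean fη r z ∂P.map (Z 0) := by
        rw [hdes.map_Z_η, integral_prod _ hint]
        simp_rw [integral_const_mul, hdes.condMean_eq]
    _ = _ := integral_map hZ.aemeasurable (hψ.mul hcm).aestronglyMeasurable

/-- The residuals `Y_i - g(Z_i)` form a regression sample with regression function `H - g`. -/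
theorem IsBerksonDesign.isRegressionSample (hdes : IsBerksonDesign P Z η ε fZ fη) {m : 𝔼 → ℝ}
    (hm : Measurable m) (hm2 : MemLp (fun ω => m (Z 0 ω + η 0 ω)) 2 P) {Y : ℕ → Ω → ℝ}
    (hY : ∀ i ω, Y i ω = m (Z i ω + η i ω) + ε i ω) {g : 𝔼 → ℝ} (hg : Measurable g)
    (hg2 : MemLp (fun ω => g (Z 0 ω)) 2 P) :
    IsRegressionSample P Z (fun i ω => Y i ω - g (Z i ω)) fZ (fun z => condMean fη m z - g z) := by
  have hZ := hdes.measurable_Z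
  have hη := hdes.measurable_η
  have hε := hdes.measurable_ε
  have hcm := measurable_condMean hdes.measurable_fη hm
  have hH2 := hdes.memLp_condMean hm hm2
  have hT : Measurable fun p : 𝔼 × 𝔼 × ℝ => (p.1, m (p.1 + p.2.1) + p.2.2 - g p.1) := by fun_prop
  have hlaw : ∀ i, P.map (fun ω => (Z i ω, η i ω, ε i ω)) = P.map fun ω => (Z 0 ω, η 0 ω, ε 0 ω) :=
    fun i => by
      rw [hdes.indep_triple i, hdes.indep_triple 0, hdes.law_Z i, hdes.law_η i, hdes.law_ε i,
        hdes.law_Z 0, hdes.law_η 0]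
  simp only [hY]
  refine ⟨hZ, fun i => ?_, hdes.measurable_fZ, hdes.fZ_nonneg, hdes.law_Z,
    hdes.indep_sample.comp (fun _ p => (p.1, m (p.1 + p.2.1) + p.2.2 - g p.1)) fun _ => hT,
    fun i => ?_, (hm2.add hdes.sq_integrable_ε).sub hg2, by fun_prop, hH2.sub hg2,
    fun ψ hψ hψ2 => ?_⟩
  · have := hZ i
    have := hη i
    have := hε i
    fun_prop
  · have h1 : ∀ j, P.map (fun ω => (Z j ω, m (Z j ω + η j ω) + ε j ω - g (Z j ω))) =
        (P.map fun ω => (Z j ω, η j ω, ε j ω)).map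
          (fun p => (p.1, m (p.1 + p.2.1) + p.2.2 - g p.1)) := fun j => by
      have := hZ j
      have := hη j
      have := hε j
      rw [Measure.map_map hT (by fun_prop)]
      rfl
    rw [h1, h1, hlaw]
  · have hi1 : Integrable (fun ω => ψ (Z 0 ω) * m (Z 0 ω + η 0 ω)) P := hψ2.integrable_mul hm2
    have hi2 : Integrable (fun ω => ψ (Z 0 ω) * ε 0 ω) P :=
      hψ2.integrable_mul hdes.sq_integrable_ε
    have hi3 : Integrable (fun ω => ψ (Z 0 ω) * g (Z 0 ω)) P := hψ2.integrable_mul hg2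
    have hi4 : Integrable (fun ω => ψ (Z 0 ω) * condMean fη m (Z 0 ω)) P := hψ2.integrable_mul hH2
    have hεz : ∫ ω, ψ (Z 0 ω) * ε 0 ω ∂P = 0 := by
      have hind : IndepFun (fun ω => ψ (Z 0 ω)) (ε 0) P :=
        hdes.indepFun_Z_ε.comp hψ measurable_id
      rw [hind.integral_fun_mul_eq_mul_integral hψ2.1 (hε 0).aestronglyMeasurable, hdes.mean_ε,
        mul_zero]
    have hi12 : Integrable (fun ω => ψ (Z 0 ω) * m (Z 0 ω + η 0 ω) + ψ (Z 0 ω) * ε 0 ω) P :=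
      hi1.add hi2
    simp only [mul_sub, mul_add]
    rw [integral_sub hi12 hi3, integral_add hi1 hi2, hεz, add_zero,
      hdes.integral_mul_condMean hm hm2 hψ hψ2, integral_sub hi4 hi3]

/-- The design points with constant responses, a regression sample with regression function `1`. -/
theorem IsBerksonDesign.isRegressionSample_one (hdes : IsBerksonDesign P Z η ε fZ fη) :
    IsRegressionSample P Z (fun _ _ => 1) fZ (fun _ => 1) := by
  have hT : Measurable fun p : 𝔼 × 𝔼 × ℝ => (p.1, (1 : ℝ)) := by fun_prop
  refine ⟨hdes.measurable_Z, fun i => measurable_const, hdes.measurable_fZ, hdes.fZ_nonneg,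
    hdes.law_Z, hdes.indep_sample.comp (fun _ p => (p.1, (1 : ℝ))) fun _ => hT, fun i => ?_,
    memLp_const _, measurable_const, memLp_const _, fun ψ _ _ => rfl⟩
  have h1 : ∀ j, P.map (fun ω => (Z j ω, (1 : ℝ))) = (P.map (Z j)).map fun z => (z, (1 : ℝ)) :=
    fun j => by
      rw [Measure.map_map (by fun_prop) (hdes.measurable_Z j)]
      rfl
  rw [h1, h1, hdes.law_Z i, hdes.law_Z 0]

theorem IsBerksonDesign.lintegral_mul_sq_ε (hdes : IsBerksonDesign P Z η ε fZ fη) {ψ : 𝔼 → ℝ≥0∞}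
    (hψ : Measurable ψ) : ∫⁻ ω, ψ (Z 0 ω) * ENNReal.ofReal (ε 0 ω ^ 2) ∂P =
      (∫⁻ ω, ENNReal.ofReal (ε 0 ω ^ 2) ∂P) * ∫⁻ ω, ψ (Z 0 ω) ∂P := by
  have hZ := hdes.measurable_Z 0
  have hε := hdes.measurable_ε 0
  have hind : IndepFun (fun ω => ψ (Z 0 ω)) (fun ω => ENNReal.ofReal (ε 0 ω ^ 2)) P :=
    hdes.indepFun_Z_ε.comp hψ (by fun_prop : Measurable fun x : ℝ => ENNReal.ofReal (x ^ 2))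
  rw [mul_comm (∫⁻ ω, ENNReal.ofReal (ε 0 ω ^ 2) ∂P)]
  exact lintegral_mul_eq_lintegral_mul_lintegral_of_indepFun (by fun_prop) (by fun_prop) hind

/-- The conditional second moment of `m(X) - H(Z)` given `Z` is the conditional variance. -/
theorem IsBerksonDesign.lintegral_mul_sq_sub_condMean (hdes : IsBerksonDesign P Z η ε fZ fη)
    {m : 𝔼 → ℝ} (hm : Measurable m) (hm2 : MemLp (fun ω => m (Z 0 ω + η 0 ω)) 2 P)
    {ψ : 𝔼 → ℝ≥0∞} (hψ : Measurable ψ) :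
    ∫⁻ ω, ψ (Z 0 ω) * ENNReal.ofReal ((m (Z 0 ω + η 0 ω) - condMean fη m (Z 0 ω)) ^ 2) ∂P =
      ∫⁻ z, ψ z * ENNReal.ofReal (condVar fη m z) ∂P.map (Z 0) := by
  have hprob := hdes.isProbabilityMeasure_η
  have hcm := measurable_condMean hdes.measurable_fη hm
  rw [hdes.lintegral_Z_η
    (F := fun z u => ψ z * ENNReal.ofReal ((m (z + u) - condMean fη m z) ^ 2)) (by fun_prop)]
  have h2 := (memLp_two_iff_lintegral hm2.1).1 hm2
  have hmm : Measurable fun z => ∫⁻ u, ENNReal.ofReal (m (z + u) ^ 2) ∂P.map (η 0) := by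
    refine Measurable.lintegral_prod_right' (f := fun p : 𝔼 × 𝔼 =>
      ENNReal.ofReal (m (p.1 + p.2) ^ 2)) ?_
    fun_prop
  rw [hdes.lintegral_Z_η (F := fun z u => ENNReal.ofReal (m (z + u) ^ 2)) (by fun_prop)] at h2
  refine lintegral_congr_ae ?_
  filter_upwards [ae_lt_top hmm h2.ne] with z hz
  have hmz : Measurable fun u => m (z + u) := by fun_prop
  have hmL : MemLp (fun u => m (z + u)) 2 (P.map (η 0)) :=
    (memLp_two_iff_lintegral hmz.aestronglyMeasurable).2 hz
  have hsub : MemLp (fun u => m (z + u) - condMean fη m z) 2 (P.map (η 0)) :=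
    hmL.sub (memLp_const _)
  rw [lintegral_const_mul _ (by fun_prop), hdes.condVar_eq,
    ofReal_integral_eq_lintegral_ofReal hsub.integrable_sq (ae_of_all _ fun _ => sq_nonneg _)]

/-- The conditional second moment of `Y` given `Z` is at most `3 (H² + γ² + E ε²)`. -/
theorem IsBerksonDesign.isTame_of_condVar_le (hdes : IsBerksonDesign P Z η ε fZ fη)
    {m : 𝔼 → ℝ} (hm : Measurable m) (hm2 : MemLp (fun ω => m (Z 0 ω + η 0 ω)) 2 P) {Y : ℕ → Ω → ℝ}
    (hY : ∀ i ω, Y i ω = m (Z i ω + η i ω) + ε i ω) {G : Measure 𝔼} {I : Set 𝔼}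
    (hcont : ∀ᵐ z ∂G, ContinuousAt (condMean fη m) z)
    (hG : HasBoundedDensity G ∨ ∃ (U : Set 𝔼) (C : ℝ), IsOpen U ∧ I ⊆ U ∧
      ∀ z ∈ U, |condMean fη m z| ≤ C ∧ condVar fη m z ≤ C) :
    IsTame P G I (Z 0) (Y 0) (condMean fη m) := by
  refine hG.imp_right fun ⟨U, C, hU, hIU, hC⟩ => ?_
  have hZ := hdes.measurable_Z 0
  have hη := hdes.measurable_η 0
  have hε := hdes.measurable_ε 0
  have hcm := measurable_condMean hdes.measurable_fη hm
  set σ : ℝ≥0∞ := ∫⁻ ω, ENNReal.ofReal (ε 0 ω ^ 2) ∂P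
  have hσ : σ < ∞ := (memLp_two_iff_lintegral hε.aestronglyMeasurable).1 hdes.sq_integrable_ε
  set c : ℝ≥0∞ := 3 * (ENNReal.ofReal C + ENNReal.ofReal (C ^ 2) + σ)
  have hc : c < ∞ := ENNReal.mul_lt_top (by simp) (by simp [hσ])
  refine ⟨U, c.toNNReal + C.toNNReal, hU, hIU, fun z hz => ?_, hcont, fun ψ hψ hψU => ?_⟩
  · refine (hC z hz).1.trans ((Real.le_coe_toNNReal C).trans ?_)
    push_cast
    linarith [ENNReal.toReal_nonneg (a := c)]
  have hψZ : Measurable fun ω => ψ (Z 0 ω) := hψ.comp hZ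
  have hvar : ∫⁻ z, ψ z * ENNReal.ofReal (condVar fη m z) ∂P.map (Z 0) ≤
      ENNReal.ofReal C * ∫⁻ ω, ψ (Z 0 ω) ∂P := by
    rw [← lintegral_map hψ hZ, ← lintegral_const_mul _ hψ]
    refine lintegral_mono fun z => ?_
    by_cases hz : z ∈ U
    · rw [mul_comm]
      gcongr
      exact (hC z hz).2
    · simp [hψU z hz]
  calc ∫⁻ ω, ψ (Z 0 ω) * ENNReal.ofReal (Y 0 ω ^ 2) ∂P
      ≤ ∫⁻ ω, 3 * (ENNReal.ofReal (C ^ 2) * ψ (Z 0 ω) + (ψ (Z 0 ω) *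
          ENNReal.ofReal ((m (Z 0 ω + η 0 ω) - condMean fη m (Z 0 ω)) ^ 2) +
          ψ (Z 0 ω) * ENNReal.ofReal (ε 0 ω ^ 2))) ∂P := by
        refine lintegral_mono fun ω => ?_
        by_cases hz : Z 0 ω ∈ U
        · have hY' : Y 0 ω = condMean fη m (Z 0 ω) +
              (m (Z 0 ω + η 0 ω) - condMean fη m (Z 0 ω)) + ε 0 ω := by
            rw [hY]; ring
          rw [hY']
          refine (mul_le_mul_right (ofReal_sq_add_add_le _ _ _) _).trans ?_
          rw [mul_left_comm, add_assoc, mul_add (ψ _), mul_add (ψ _),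
            mul_comm (ψ _) (ENNReal.ofReal (condMean fη m (Z 0 ω) ^ 2))]
          gcongr 3 * (ENNReal.ofReal ?_ * _ + _)
          have := abs_le.1 (hC _ hz).1
          exact sq_le_sq' this.1 this.2
        · simp [hψU _ hz]
    _ ≤ 3 * (ENNReal.ofReal (C ^ 2) * ∫⁻ ω, ψ (Z 0 ω) ∂P +
          (ENNReal.ofReal C * ∫⁻ ω, ψ (Z 0 ω) ∂P + σ * ∫⁻ ω, ψ (Z 0 ω) ∂P)) := by
        rw [lintegral_const_mul _ (by fun_prop), lintegral_add_left (by fun_prop),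
          lintegral_add_left (by fun_prop), lintegral_const_mul _ hψZ,
          hdes.lintegral_mul_sq_ε hψ, hdes.lintegral_mul_sq_sub_condMean hm hm2 hψ]
        gcongr
    _ = c * ∫⁻ ω, ψ (Z 0 ω) ∂P := by
        simp only [c]
        ring
    _ ≤ _ := by
        gcongr
        push_cast
        rw [ENNReal.coe_toNNReal hc.ne]
        exact le_self_add

/-- If `m` and `s` are bounded, then no localization near `I` is needed, and the continuity of the
regression function is automatic. -/
theorem IsBerksonDesign.isTame_of_bounded (hdes : IsBerksonDesign P Z η ε fZ fη)
    {m : 𝔼 → ℝ} (hm : Measurable m) {Y : ℕ → Ω → ℝ}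
    (hY : ∀ i ω, Y i ω = m (Z i ω + η i ω) + ε i ω) {s : 𝔼 → ℝ} (hs : Measurable s)
    {G : Measure 𝔼} {I : Set 𝔼}
    (hG : HasBoundedDensity G ∨ ((∃ C : ℝ, ∀ x, |m x| ≤ C) ∧ ∃ C : ℝ, ∀ x, |s x| ≤ C)) :
    IsTame P G I (Z 0) (fun ω => Y 0 ω - condMean fη s (Z 0 ω))
      (fun z => condMean fη m z - condMean fη s z) := by
  refine hG.imp_right fun ⟨⟨C₁, h₁⟩, ⟨C₂, h₂⟩⟩ => ?_
  have hZ := hdes.measurable_Z 0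
  have hη := hdes.measurable_η 0
  have hε := hdes.measurable_ε 0
  have hcs := measurable_condMean hdes.measurable_fη hs
  have hC₁ : 0 ≤ C₁ := (abs_nonneg _).trans (h₁ 0)
  have hC₂ : 0 ≤ C₂ := (abs_nonneg _).trans (h₂ 0)
  set σ : ℝ≥0∞ := ∫⁻ ω, ENNReal.ofReal (ε 0 ω ^ 2) ∂P
  have hσ : σ < ∞ := (memLp_two_iff_lintegral hε.aestronglyMeasurable).1 hdes.sq_integrable_ε
  set c : ℝ≥0∞ := 3 * (ENNReal.ofReal (C₁ ^ 2) + ENNReal.ofReal (C₂ ^ 2) + σ)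
  have hc : c < ∞ := ENNReal.mul_lt_top (by simp) (by simp [hσ])
  refine ⟨Set.univ, c.toNNReal + (C₁ + C₂).toNNReal, isOpen_univ, Set.subset_univ _, fun z _ => ?_,
    ae_of_all _ fun z => ((continuous_condMean hdes.integrable_fη hm h₁).sub
      (continuous_condMean hdes.integrable_fη hs h₂)).continuousAt, fun ψ hψ _ => ?_⟩
  · have := (abs_sub _ _).trans (add_le_add (hdes.abs_condMean_le h₁ z) (hdes.abs_condMean_le h₂ z))
    refine this.trans ((Real.le_coe_toNNReal _).trans ?_)
    push_cast
    linarith [ENNReal.toReal_nonneg (a := c)]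
  have hψZ : Measurable fun ω => ψ (Z 0 ω) := hψ.comp hZ
  calc ∫⁻ ω, ψ (Z 0 ω) * ENNReal.ofReal ((Y 0 ω - condMean fη s (Z 0 ω)) ^ 2) ∂P
      ≤ ∫⁻ ω, 3 * ((ENNReal.ofReal (C₁ ^ 2) + ENNReal.ofReal (C₂ ^ 2)) * ψ (Z 0 ω) +
          ψ (Z 0 ω) * ENNReal.ofReal (ε 0 ω ^ 2)) ∂P := by
        refine lintegral_mono fun ω => ?_
        rw [hY, show m (Z 0 ω + η 0 ω) + ε 0 ω - condMean fη s (Z 0 ω) =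
          m (Z 0 ω + η 0 ω) + (-condMean fη s (Z 0 ω)) + ε 0 ω by ring]
        refine (mul_le_mul_right (ofReal_sq_add_add_le _ _ _) _).trans ?_
        rw [mul_left_comm, mul_add (ψ _), mul_comm (_ + _) (ψ _)]
        gcongr 3 * (_ * (ENNReal.ofReal ?_ + ENNReal.ofReal ?_) + _)
        · exact sq_le_sq' (abs_le.1 (h₁ _)).1 (abs_le.1 (h₁ _)).2
        · rw [neg_sq]
          have := abs_le.1 (hdes.abs_condMean_le h₂ (Z 0 ω))
          exact sq_le_sq' this.1 this.2
    _ = c * ∫⁻ ω, ψ (Z 0 ω) ∂P := by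
        rw [lintegral_const_mul _ (by fun_prop), lintegral_add_left (by fun_prop),
          lintegral_const_mul _ hψZ, hdes.lintegral_mul_sq_ε hψ, ← add_mul, ← mul_assoc]
    _ ≤ _ := by
        gcongr
        push_cast
        rw [ENNReal.coe_toNNReal hc.ne]
        exact le_self_add

end Model

/-! ### Uniformity in the parameter -/

theorem measurable_regressionEst {K Ks : 𝔼 → ℝ} (hK : IsKernel K) (hKs : IsKernel Ks) (h w : ℝ)
    (n : ℕ) (Zs : ℕ → 𝔼) (Vs : ℕ → ℝ) : Measurable (regressionEst K Ks h w n Zs Vs) := by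
  have := hK.measurable_scaled h
  have := hKs.measurable_scaled w
  unfold regressionEst densityEst
  fun_prop

theorem IsKernel.densityEst_nonneg {Ks : 𝔼 → ℝ} (hKs : IsKernel Ks) {w : ℝ} (hw : 0 < w) (n : ℕ)
    (Zs : ℕ → 𝔼) (z : 𝔼) : 0 ≤ densityEst Ks w n Zs z :=
  mul_nonneg (by positivity) (Finset.sum_nonneg fun _ _ => hKs.scaled_nonneg hw _)

/-- If two response vectors differ by at most `c` at the design points in `I`, then the regression
estimators differ by at most `c` times the estimator of the constant `1`, at all points whose
distance to the complement of `I` exceeds the bandwidth. -/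
theorem IsKernel.abs_regressionEst_sub_le {K Ks : 𝔼 → ℝ} (hK : IsKernel K) (hKs : IsKernel Ks)
    {h w : ℝ} (hh : 0 < h) (hw : 0 < w) (n : ℕ) {Zs : ℕ → 𝔼} {Vs Vs' : ℕ → ℝ} {I : Set 𝔼} {c δ : ℝ}
    (hδ : √d * h < δ) (hV : ∀ i, Zs i ∈ I → |Vs i - Vs' i| ≤ c) {z : 𝔼}
    (hz : z ∉ Metric.thickening δ Iᶜ) :
    |regressionEst K Ks h w n Zs Vs z - regressionEst K Ks h w n Zs Vs' z| ≤
      c * |regressionEst K Ks h w n Zs (fun _ => 1) z| := by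
  have hden : 0 ≤ n * densityEst Ks w n Zs z :=
    mul_nonneg (Nat.cast_nonneg n) (hKs.densityEst_nonneg hw n Zs z)
  have hnum : 0 ≤ ∑ i ∈ Finset.range n, scaled K h (z - Zs i) * 1 :=
    Finset.sum_nonneg fun i _ => mul_nonneg (hK.scaled_nonneg hh _) zero_le_one
  unfold regressionEst
  rw [← sub_div, ← Finset.sum_sub_distrib, abs_div, abs_div, abs_of_nonneg hden,
    abs_of_nonneg hnum, ← mul_div_assoc, Finset.mul_sum]
  gcongr
  refine (Finset.abs_sum_le_sum_abs _ _).trans (Finset.sum_le_sum fun i _ => ?_)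
  rw [← mul_sub, abs_mul, abs_of_nonneg (hK.scaled_nonneg hh _), mul_one, mul_comm c]
  by_cases h0 : scaled K h (z - Zs i) = 0
  · simp [h0]
  · gcongr
    · exact hK.scaled_nonneg hh _
    · refine hV i ?_
      by_contra hi
      refine hz (Metric.mem_thickening_iff.2 ⟨Zs i, hi, ?_⟩)
      rw [dist_eq_norm]
      exact (hK.norm_le_of_scaled_ne_zero hh h0).trans_lt hδ

section Uniform

variable {Ω : Type*} [MeasurableSpace Ω] {P : Measure Ω} {q : ℕ}

/-- Convergence of the criterion, uniformly in the parameter, on the part of `I` at distance at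
least `δ` from the complement of `I`. The Hölder condition holds on `I` only, and this is where
the kernel sees no design point outside `I`. -/
theorem tendsto_measure_exists_eLpNorm {Θ : Set (EuclideanSpace ℝ (Fin q))} (hΘ : IsCompact Θ)
    (G : Measure 𝔼) [IsFiniteMeasure G] {I : Set 𝔼} (hGI : G Iᶜ = 0) {H : 𝔼 → ℝ}
    (hH : AEStronglyMeasurable H G) {F : EuclideanSpace ℝ (Fin q) → 𝔼 → ℝ}
    (hF : ∀ θ ∈ Θ, AEStronglyMeasurable (F θ) G) {C β : ℝ} (hC : 0 ≤ C) (hβ : 0 < β)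
    (hHol : ∀ θ₁ ∈ Θ, ∀ θ₂ ∈ Θ, ∀ z ∈ I, |F θ₂ z - F θ₁ z| ≤ ‖θ₂ - θ₁‖ ^ β * C)
    {K Ks : 𝔼 → ℝ} (hK : IsKernel K) (hKs : IsKernel Ks) {h w : ℕ → ℝ} (hpos : ∀ n, 0 < h n)
    (h1 : Tendsto h atTop (𝓝 0)) (hw0 : ∀ᶠ n in atTop, 0 < w n) {Z : ℕ → Ω → 𝔼} {Y : ℕ → Ω → ℝ}
    (hfix : ∀ θ ∈ Θ, ∀ e : ℝ, 0 < e → Tendsto (fun n => P {ω | ENNReal.ofReal e ≤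
      eLpNorm (fun z => regressionEst K Ks (h n) (w n) n (fun i => Z i ω)
        (fun i => Y i ω - F θ (Z i ω)) z - (H z - F θ z)) 2 G}) atTop (𝓝 0))
    (hone : Tendsto (fun n => P {ω | ENNReal.ofReal 1 ≤
      eLpNorm (fun z => regressionEst K Ks (h n) (w n) n (fun i => Z i ω)
        (fun _ => 1) z - 1) 2 G}) atTop (𝓝 0))
    {δ : ℝ} (hδ : 0 < δ) {e : ℝ} (he : 0 < e) :
    Tendsto (fun n => P {ω | ∃ θ ∈ Θ, ENNReal.ofReal e ≤
      eLpNorm (fun z => regressionEst K Ks (h n) (w n) n (fun i => Z i ω)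
        (fun i => Y i ω - F θ (Z i ω)) z - (H z - F θ z)) 2
        (G.restrict (Metric.thickening δ Iᶜ)ᶜ)}) atTop (𝓝 0) := by
  have hmGtop : G Set.univ ^ (2⁻¹ : ℝ) ≠ ∞ :=
    ENNReal.rpow_ne_top_of_nonneg (by norm_num) (measure_ne_top _ _)
  set a : ℝ := (G Set.univ ^ (2⁻¹ : ℝ)).toReal
  have ha : 0 ≤ a := ENNReal.toReal_nonneg
  have haG : G Set.univ ^ (2⁻¹ : ℝ) = ENNReal.ofReal a := (ENNReal.ofReal_toReal hmGtop).symm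
  -- the mesh `τ` of the finite net in `Θ`
  obtain ⟨τ, hτ, hτe⟩ : ∃ τ > 0, τ ^ β * C * (1 + 2 * a) ≤ e / 2 := by
    set x : ℝ := e / (2 * (C + 1) * (1 + 2 * a))
    have hx : 0 < x := by positivity
    refine ⟨x ^ β⁻¹, Real.rpow_pos_of_pos hx _, ?_⟩
    rw [Real.rpow_inv_rpow hx.le hβ.ne']
    calc x * C * (1 + 2 * a) ≤ x * (C + 1) * (1 + 2 * a) := by gcongr; linarith
      _ = e / 2 := by simp only [x]; field_simp
  set c : ℝ := τ ^ β * C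
  have hc : 0 ≤ c := mul_nonneg (Real.rpow_nonneg hτ.le _) hC
  obtain ⟨T, hTΘ, hTfin, hTcov⟩ := hΘ.finite_cover_balls hτ
  lift T to Finset (EuclideanSpace ℝ (Fin q)) using hTfin
  have hsum := (tendsto_finsetSum T fun θ hθ => hfix θ (hTΘ hθ) (e / 4) (by positivity)).add hone
  rw [Finset.sum_const_zero, add_zero] at hsum
  refine tendsto_of_tendsto_of_tendsto_of_le_of_le' tendsto_const_nhds hsum
    (Eventually.of_forall fun _ => zero_le) ?_
  have hsm : Tendsto (fun n => √d * h n) atTop (𝓝 0) := by simpa using h1.const_mul √d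
  filter_upwards [hsm.eventually (gt_mem_nhds hδ), hw0] with n hn hwn
  refine le_trans (measure_mono ?_) ((measure_union_le _ _).trans
    (add_le_add (measure_biUnion_finset_le T _) le_rfl))
  rintro ω ⟨θ, hθ, hωe⟩
  by_contra hcon
  obtain ⟨hnet, hone'⟩ := not_or.1 hcon
  have hone' : eLpNorm (fun z => regressionEst K Ks (h n) (w n) n (fun i => Z i ω)
        (fun _ => 1) z - 1) 2 G < ENNReal.ofReal 1 := not_le.1 hone'
  obtain ⟨θ', hθ'T, hθθ'⟩ := Set.mem_iUnion₂.1 (hTcov hθ)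
  have hθ' : θ' ∈ Θ := hTΘ hθ'T
  have hnet : eLpNorm (fun z => regressionEst K Ks (h n) (w n) n (fun i => Z i ω)
        (fun i => Y i ω - F θ' (Z i ω)) z - (H z - F θ' z)) 2 G < ENNReal.ofReal (e / 4) := by
    by_contra h0
    exact hnet (Set.mem_iUnion₂.2 ⟨θ', hθ'T, not_lt.1 h0⟩)
  have hdiff : ∀ z ∈ I, |F θ z - F θ' z| ≤ c := fun z hz => by
    refine (hHol θ' hθ' θ hθ z hz).trans ?_
    have : ‖θ - θ'‖ ≤ τ := by
      rw [← dist_eq_norm]; exact (Metric.mem_ball.1 hθθ').le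
    simp only [c]
    gcongr
  set E : EuclideanSpace ℝ (Fin q) → 𝔼 → ℝ := fun θ => regressionEst K Ks (h n) (w n) n
    (fun i => Z i ω) fun i => Y i ω - F θ (Z i ω)
  set E₁ : 𝔼 → ℝ := regressionEst K Ks (h n) (w n) n (fun i => Z i ω) fun _ => 1
  have hEm : ∀ θ, Measurable (E θ) := fun θ => measurable_regressionEst hK hKs _ _ _ _ _
  have hE₁m : Measurable E₁ := measurable_regressionEst hK hKs _ _ _ _ _
  set S := (Metric.thickening δ Iᶜ)ᶜ
  have hSm : MeasurableSet S := Metric.isOpen_thickening.measurableSet.compl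
  have hone2 : eLpNorm E₁ 2 G ≤ ENNReal.ofReal (1 + a) := by
    calc eLpNorm E₁ 2 G = eLpNorm ((fun z => E₁ z - 1) + fun _ => 1) 2 G :=
          congrArg (eLpNorm · 2 G) (by ext z; simp)
      _ ≤ eLpNorm (fun z => E₁ z - 1) 2 G + eLpNorm (fun _ => (1 : ℝ)) 2 G :=
          eLpNorm_add_le (hE₁m.sub_const 1).aestronglyMeasurable aestronglyMeasurable_const
            (by norm_num)
      _ ≤ ENNReal.ofReal 1 + G Set.univ ^ (2⁻¹ : ℝ) * ENNReal.ofReal 1 :=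
          add_le_add hone'.le (eLpNorm_two_le_of_ae_abs_le (ae_of_all _ fun _ => by simp))
      _ = ENNReal.ofReal (1 + a) := by
          rw [haG, ENNReal.ofReal_one, mul_one, ENNReal.ofReal_add zero_le_one ha,
            ENNReal.ofReal_one]
  have hp2 : eLpNorm (fun z => E θ z - E θ' z) 2 (G.restrict S) ≤ ENNReal.ofReal (c * (1 + a)) := by
    have hle : ∀ᵐ z ∂G.restrict S, ‖E θ z - E θ' z‖ ≤ c * ‖E₁ z‖ := by
      filter_upwards [ae_restrict_mem hSm] with z hz
      refine hK.abs_regressionEst_sub_le hKs (hpos n) hwn n hn (fun i hi => ?_) hz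
      rw [sub_sub_sub_cancel_left, abs_sub_comm]
      exact hdiff _ hi
    calc eLpNorm (fun z => E θ z - E θ' z) 2 (G.restrict S)
        ≤ ENNReal.ofReal c * eLpNorm E₁ 2 (G.restrict S) :=
          eLpNorm_le_mul_eLpNorm_of_ae_le_mul hle 2
      _ ≤ ENNReal.ofReal c * ENNReal.ofReal (1 + a) := by
          gcongr
          exact (eLpNorm_mono_measure _ Measure.restrict_le_self).trans hone2
      _ = _ := (ENNReal.ofReal_mul hc).symm
  have hp3 : eLpNorm (fun z => F θ z - F θ' z) 2 (G.restrict S) ≤ ENNReal.ofReal (a * c) := by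
    refine (eLpNorm_mono_measure _ Measure.restrict_le_self).trans
      ((eLpNorm_two_le_of_ae_abs_le (c := c) ?_).trans_eq ?_)
    · filter_upwards [measure_eq_zero_iff_ae_notMem.1 hGI] with z hz
      exact hdiff z (Set.notMem_compl_iff.1 hz)
    · rw [haG, ENNReal.ofReal_mul ha]
  have hm1 : AEStronglyMeasurable (fun z => E θ' z - (H z - F θ' z)) (G.restrict S) :=
    ((hEm θ').aestronglyMeasurable.sub (hH.sub (hF θ' hθ'))).restrict
  have hm2 : AEStronglyMeasurable (fun z => E θ z - E θ' z) (G.restrict S) :=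
    ((hEm θ).sub (hEm θ')).aestronglyMeasurable
  have hm3 : AEStronglyMeasurable (fun z => F θ z - F θ' z) (G.restrict S) :=
    ((hF θ hθ).sub (hF θ' hθ')).restrict
  have htot : eLpNorm (fun z => E θ z - (H z - F θ z)) 2 (G.restrict S) ≤
      ENNReal.ofReal (e / 4) + ENNReal.ofReal (c * (1 + a)) + ENNReal.ofReal (a * c) := by
    calc eLpNorm (fun z => E θ z - (H z - F θ z)) 2 (G.restrict S)
        = eLpNorm ((fun z => E θ' z - (H z - F θ' z)) + (fun z => E θ z - E θ' z) +
            fun z => F θ z - F θ' z) 2 (G.restrict S) :=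
          congrArg (eLpNorm · 2 (G.restrict S)) (by ext z; simp only [Pi.add_apply]; ring)
      _ ≤ eLpNorm (fun z => E θ' z - (H z - F θ' z)) 2 (G.restrict S) +
            eLpNorm (fun z => E θ z - E θ' z) 2 (G.restrict S) +
            eLpNorm (fun z => F θ z - F θ' z) 2 (G.restrict S) :=
          (eLpNorm_add_le (hm1.add hm2) hm3 (by norm_num)).trans
            (add_le_add (eLpNorm_add_le hm1 hm2 (by norm_num)) le_rfl)
      _ ≤ _ := add_le_add (add_le_add
          ((eLpNorm_mono_measure _ Measure.restrict_le_self).trans hnet.le) hp2) hp3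
  have hfin := hωe.trans htot
  rw [← ENNReal.ofReal_add (by positivity) (by positivity),
    ← ENNReal.ofReal_add (by positivity) (by positivity),
    ENNReal.ofReal_le_ofReal_iff (by positivity)] at hfin
  nlinarith

end Uniform

/-! ### Consistency of the two estimators -/

theorem critStar_eq (G : Measure 𝔼) (K Ks : 𝔼 → ℝ) (h w : ℝ) (n : ℕ) (Zs : ℕ → 𝔼) (Ys : ℕ → ℝ)
    (Hθ : 𝔼 → ℝ) : critStar G K Ks h w n Zs Ys Hθ =
      eLpNorm (fun z => regressionEst K Ks h w n Zs Ys z - Hθ z) 2 G ^ 2 :=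
  lintegral_ofReal_sq_eq _

theorem crit_eq (G : Measure 𝔼) (K Ks : 𝔼 → ℝ) (h w : ℝ) (n : ℕ) (Zs : ℕ → 𝔼) (Ys : ℕ → ℝ)
    (Hθ : 𝔼 → ℝ) : crit G K Ks h w n Zs Ys Hθ =
      eLpNorm (regressionEst K Ks h w n Zs fun i => Ys i - Hθ (Zs i)) 2 G ^ 2 :=
  lintegral_ofReal_sq_eq _

/-- If `Θ` has a second point, then `ρ(H, H_θ)` is finite at the unique minimizer, and the Hölder
condition puts all `H_θ` in `L²(G)`. -/
theorem memLp_of_unique_minimizer {q : ℕ} {Θ : Set (EuclideanSpace ℝ (Fin q))} {G : Measure 𝔼}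
    [IsFiniteMeasure G] {H : 𝔼 → ℝ} (hH : MemLp H 2 G) {F : EuclideanSpace ℝ (Fin q) → 𝔼 → ℝ}
    (hF : ∀ θ ∈ Θ, Measurable (F θ)) {C β : ℝ}
    (hHol : ∀ θ₁ ∈ Θ, ∀ θ₂ ∈ Θ, ∀ᵐ z ∂G, |F θ₂ z - F θ₁ z| ≤ ‖θ₂ - θ₁‖ ^ β * C)
    {θT θ' : EuclideanSpace ℝ (Fin q)} (hθT : θT ∈ Θ) (hlt : rho G H (F θT) < rho G H (F θ'))
    {θ : EuclideanSpace ℝ (Fin q)} (hθ : θ ∈ Θ) : MemLp (F θ) 2 G := by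
  have h1 : MemLp (fun z => H z - F θT z) 2 G :=
    (memLp_two_iff_lintegral (hH.1.sub (hF _ hθT).aestronglyMeasurable)).2 hlt.lt_top
  have h2 : MemLp (fun z => F θ z - F θT z) 2 G :=
    MemLp.of_bound ((hF _ hθ).sub (hF _ hθT)).aestronglyMeasurable _ (hHol θT hθT θ hθ)
  refine ((hH.sub h1).add h2).ae_eq (ae_of_all _ fun z => ?_)
  simp

theorem tendstoInMeasure_of_subsingleton {Ω : Type*} [MeasurableSpace Ω] {P : Measure Ω} {q : ℕ}
    {Θ : Set (EuclideanSpace ℝ (Fin q))} {θT : EuclideanSpace ℝ (Fin q)}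
    (h : ∀ θ ∈ Θ, θ = θT) {θs : ℕ → Ω → EuclideanSpace ℝ (Fin q)}
    (hθs : ∀ᶠ n in atTop, ∀ᵐ ω ∂P, θs n ω ∈ Θ) :
    TendstoInMeasure P θs atTop fun _ => θT := by
  refine tendstoInMeasure_of_dist fun r hr => tendsto_const_nhds.congr' ?_
  filter_upwards [hθs] with n hn
  refine (measure_eq_zero_iff_ae_notMem.2 ?_).symm
  filter_upwards [hn] with ω hω hr'
  have hr' : r ≤ dist (θs n ω) θT := hr'
  rw [h _ hω, dist_self] at hr'
  exact hr.not_ge hr'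

/-- For closed `I` with `G`-null complement and boundary, `G`-almost every point has positive
distance to the complement of `I`. -/
theorem ae_eventually_notMem_thickening {G : Measure 𝔼} {I : Set 𝔼} (hI : IsClosed I)
    (hGI : G Iᶜ = 0) (hfr : G (frontier I) = 0) :
    ∀ᵐ z ∂G, ∀ᶠ k : ℕ in atTop, z ∈ (Metric.thickening (1 / ((k : ℝ) + 1)) Iᶜ)ᶜ := by
  filter_upwards [measure_eq_zero_iff_ae_notMem.1 hGI, measure_eq_zero_iff_ae_notMem.1 hfr]
    with z hz1 hz2
  rw [Set.notMem_compl_iff] at hz1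
  have hint : z ∈ interior I := by
    by_contra h0
    exact hz2 ⟨hI.closure_eq.symm ▸ hz1, h0⟩
  obtain ⟨δ, hδ, hball⟩ := Metric.isOpen_iff.1 isOpen_interior z hint
  filter_upwards [tendsto_one_div_add_atTop_nhds_zero_nat.eventually (gt_mem_nhds hδ)] with k hk
  rw [Set.mem_compl_iff, Metric.mem_thickening_iff]
  rintro ⟨y, hy, hzy⟩
  exact hy (interior_subset (hball (Metric.mem_ball'.2 (hzy.trans hk))))

end Berkson

theorem lemma3p2 {Ω : Type*} [MeasurableSpace Ω] (P : Measure Ω) [IsProbabilityMeasure P]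
    {d q : ℕ} (hd : 1 ≤ d)
    -- the compact sets of design points and of parameters
    (I : Set (EuclideanSpace ℝ (Fin d))) (hI : IsCompact I)
    (Θ : Set (EuclideanSpace ℝ (Fin q))) (hΘ : IsCompact Θ)
    -- the integrating measure
    (G : Measure (EuclideanSpace ℝ (Fin d))) [IsFiniteMeasure G] (hGI : G Iᶜ = 0)
    -- the kernels and the bandwidths
    (K Ks : EuclideanSpace ℝ (Fin d) → ℝ) (hK : Berkson.IsKernel K) (hKs : Berkson.IsKernel Ks)
    (hKsLip : ∃ L : ℝ≥0, LipschitzWith L Ks)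
    (h w : ℕ → ℝ) (hpos : ∀ n, 0 < h n) (h1 : Tendsto h atTop (𝓝 0))
    (h2 : Tendsto (fun n : ℕ => (n : ℝ) * h n ^ (2 * d)) atTop atTop)
    (hw : ∃ c : ℝ, 0 < c ∧ Tendsto
      (fun n : ℕ => w n / (Real.log n / n) ^ ((1 : ℝ) / ((d : ℝ) + 4))) atTop (𝓝 c))
    -- errors and design
    (Z η : ℕ → Ω → EuclideanSpace ℝ (Fin d)) (ε : ℕ → Ω → ℝ)
    (fZ fη : EuclideanSpace ℝ (Fin d) → ℝ) (hdes : Berkson.IsBerksonDesign P Z η ε fZ fη)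
    (f1 : Berkson.DensityCondition fZ I)
    -- the true regression function and the responses
    (m : EuclideanSpace ℝ (Fin d) → ℝ) (hm : Measurable m)
    (hm2 : MemLp (fun ω => m (Z 0 ω + η 0 ω)) 2 P)
    (Y : ℕ → Ω → ℝ) (hY : ∀ i ω, Y i ω = m (Z i ω + η i ω) + ε i ω)
    -- the parametric family
    (mθ : EuclideanSpace ℝ (Fin q) → EuclideanSpace ℝ (Fin d) → ℝ)
    (hmθ : ∀ θ ∈ Θ, Measurable (mθ θ))
    (hmθ1 : ∀ θ ∈ Θ, Integrable (fun ω => mθ θ (Z 0 ω + η 0 ω)) P)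
    (m3 : Berkson.HolderCondition Θ I (fun θ => Berkson.condMean fη (mθ θ)))
    -- `H` is in `L₂(G)` and `T(H) = θT` is the unique minimizer of `ρ(H, H_θ)`
    (hH : MemLp (Berkson.condMean fη m) 2 G)
    (θT : EuclideanSpace ℝ (Fin q)) (hθT : θT ∈ Θ)
    (huniq : ∀ θ ∈ Θ, θ ≠ θT →
      Berkson.rho G (Berkson.condMean fη m) (Berkson.condMean fη (mθ θT)) <
        Berkson.rho G (Berkson.condMean fη m) (Berkson.condMean fη (mθ θ))) :
    -- part (a)
    ((∀ᵐ z ∂G, ContinuousAt (Berkson.condMean fη m) z) →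
      (∀ᵐ z ∂G, ContinuousAt (Berkson.condVar fη m) z) →
      (Berkson.HasBoundedDensity G ∨
        ∃ (U : Set (EuclideanSpace ℝ (Fin d))) (C : ℝ), IsOpen U ∧ I ⊆ U ∧
          ∀ z ∈ U, |Berkson.condMean fη m z| ≤ C ∧ Berkson.condVar fη m z ≤ C) →
      ∀ θs : ℕ → Ω → EuclideanSpace ℝ (Fin q),
        (∀ᶠ n in atTop, ∀ᵐ ω ∂P, Berkson.IsArgmin Θ
          (fun θ => Berkson.critStar G K Ks (h n) (w n) n (fun i => Z i ω) (fun i => Y i ω)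
            (Berkson.condMean fη (mθ θ))) (θs n ω)) →
        TendstoInMeasure P θs atTop (fun _ => θT)) ∧
    -- part (b)
    (ContinuousOn m I →
      (∀ θ ∈ Θ, MemLp (fun ω => mθ θ (Z 0 ω + η 0 ω)) 2 P) →
      G (frontier I) = 0 →
      (Berkson.HasBoundedDensity G ∨
        ((∃ C : ℝ, ∀ x, |m x| ≤ C) ∧ ∀ θ ∈ Θ, ∃ C : ℝ, ∀ x, |mθ θ x| ≤ C)) →
      ∀ θh : ℕ → Ω → EuclideanSpace ℝ (Fin q),
        (∀ᶠ n in atTop, ∀ᵐ ω ∂P, Berkson.IsArgmin Θ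
          (fun θ => Berkson.crit G K Ks (h n) (w n) n (fun i => Z i ω) (fun i => Y i ω)
            (Berkson.condMean fη (mθ θ))) (θh n ω)) →
        TendstoInMeasure P θh atTop (fun _ => θT)) := by
  obtain ⟨L, hL⟩ := hKsLip
  obtain ⟨c, hc, hwc⟩ := hw
  obtain ⟨hw0, hwt, hnw⟩ := Berkson.eventually_bandwidth hc hwc
  obtain ⟨ℓ, β, hℓ, -, hβ, -, hHol⟩ := m3
  obtain ⟨C, hC⟩ := hI.exists_bound_of_continuousOn hℓ
  have hcm := fun {r} hr => Berkson.measurable_condMean (r := r) hdes.measurable_fη hr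
  have hHolI : ∀ θ₁ ∈ Θ, ∀ θ₂ ∈ Θ, ∀ z ∈ I, |Berkson.condMean fη (mθ θ₂) z -
      Berkson.condMean fη (mθ θ₁) z| ≤ ‖θ₂ - θ₁‖ ^ β * |C| := fun θ₁ hθ₁ θ₂ hθ₂ z hz =>
    (hHol θ₁ hθ₁ θ₂ hθ₂ z hz).trans (mul_le_mul_of_nonneg_left
      ((le_abs_self _).trans ((hC z hz).trans (le_abs_self C))) (by positivity))
  have hHolG : ∀ θ₁ ∈ Θ, ∀ θ₂ ∈ Θ, ∀ᵐ z ∂G, |Berkson.condMean fη (mθ θ₂) z -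
      Berkson.condMean fη (mθ θ₁) z| ≤ ‖θ₂ - θ₁‖ ^ β * |C| := fun θ₁ hθ₁ θ₂ hθ₂ => by
    filter_upwards [measure_eq_zero_iff_ae_notMem.1 hGI] with z hz
    exact hHolI θ₁ hθ₁ θ₂ hθ₂ z (Set.notMem_compl_iff.1 hz)
  -- If `Θ` is a singleton, then `ρ(H, H_θ)` may be infinite, but there is nothing to estimate.
  by_cases hsub : ∀ θ ∈ Θ, θ = θT
  · refine ⟨fun _ _ _ θs hθs => ?_, fun _ _ _ _ θh hθh => ?_⟩
    · exact Berkson.tendstoInMeasure_of_subsingleton hsub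
        (hθs.mono fun n hn => hn.mono fun ω hω => hω.1)
    · exact Berkson.tendstoInMeasure_of_subsingleton hsub
        (hθh.mono fun n hn => hn.mono fun ω hω => hω.1)
  push Not at hsub
  obtain ⟨θ₀, hθ₀, hne⟩ := hsub
  have hF : ∀ θ ∈ Θ, MemLp (Berkson.condMean fη (mθ θ)) 2 G := fun θ hθ =>
    Berkson.memLp_of_unique_minimizer hH (F := fun θ => Berkson.condMean fη (mθ θ))
      (fun θ hθ => hcm (hmθ θ hθ)) hHolG hθT (huniq θ₀ hθ₀ hne) hθ
  refine ⟨fun hHc _ hG θs hθs => ?_, fun _ hmθ2 hfr hG θh hθh => ?_⟩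
  -- The error `estimator - H` does not depend on `θ`, so no exhaustion is needed and
  -- `S k` is the whole space.
  · have hs := hdes.isRegressionSample hm hm2 hY measurable_const (g := fun _ => 0) (memLp_const _)
    simp only [sub_zero] at hs
    have hlim : ∀ e : ℝ, 0 < e → _ := fun e he => hs.tendsto_measure_eLpNorm hK hKs hL hI f1 G hGI
      (hdes.isTame_of_condVar_le hm hm2 hY hHc hG) hH hpos h1 h2 hw0 hwt hnw he
    have hcancel : ∀ a b b' : ℝ, a - b - (b' - b) = a - b' := fun a b b' => by ring
    simp only [Berkson.critStar_eq] at hθs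
    refine Berkson.tendstoInMeasure_argmin hΘ G hH hF (abs_nonneg C) hβ hHolG hθT huniq
      (D := fun n ω θ z => Berkson.regressionEst K Ks (h n) (w n) n (fun i => Z i ω)
        (fun i => Y i ω) z - Berkson.condMean fη (mθ θ) z) (fun n ω θ hθ =>
        ((Berkson.measurable_regressionEst hK hKs _ _ _ _ _).sub
          (hcm (hmθ θ hθ))).aestronglyMeasurable)
      (S := fun _ => Set.univ) (fun _ => MeasurableSet.univ)
      (ae_of_all _ fun z => Eventually.of_forall fun _ => Set.mem_univ z) ?_ ?_ hθs
    · intro e he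
      simpa only [hcancel] using hlim e he
    · intro _ e he
      simp only [hcancel, Measure.restrict_univ]
      refine tendsto_of_tendsto_of_tendsto_of_le_of_le tendsto_const_nhds (hlim e he)
        (fun _ => zero_le) fun n => measure_mono ?_
      rintro ω ⟨θ, -, hω⟩
      exact hω
  -- Here `S k` is the set of points at distance at least `1 / (k + 1)` from the complement of `I`.
  · have hfix : ∀ θ ∈ Θ, ∀ e : ℝ, 0 < e → _ := fun θ hθ e he =>
      (hdes.isRegressionSample hm hm2 hY (hcm (hmθ θ hθ))
        (hdes.memLp_condMean (hmθ θ hθ) (hmθ2 θ hθ))).tendsto_measure_eLpNorm hK hKs hL hI f1 G hGI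
        (hdes.isTame_of_bounded hm hY (hmθ θ hθ) (hG.imp_right fun h0 => ⟨h0.1, h0.2 θ hθ⟩))
        (hH.sub (hF θ hθ)) hpos h1 h2 hw0 hwt hnw he
    have hone := hdes.isRegressionSample_one.tendsto_measure_eLpNorm hK hKs hL hI f1 G hGI
      (Or.inr ⟨Set.univ, 1, isOpen_univ, Set.subset_univ _, by simp,
        ae_of_all _ fun _ => continuousAt_const, fun ψ _ _ => by simp⟩)
      (memLp_const _) hpos h1 h2 hw0 hwt hnw one_pos
    simp only [Berkson.crit_eq] at hθh
    exact Berkson.tendstoInMeasure_argmin hΘ G hH hF (abs_nonneg C) hβ hHolG hθT huniq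
      (D := fun n ω θ => Berkson.regressionEst K Ks (h n) (w n) n (fun i => Z i ω)
        (fun i => Y i ω - Berkson.condMean fη (mθ θ) (Z i ω))) (fun n ω θ hθ =>
        (Berkson.measurable_regressionEst hK hKs _ _ _ _ _).aestronglyMeasurable)
      (fun k => Metric.isOpen_thickening.measurableSet.compl)
      (Berkson.ae_eventually_notMem_thickening hI.isClosed hGI hfr) (hfix θT hθT)
      (fun k e he => Berkson.tendsto_measure_exists_eLpNorm hΘ G hGI hH.1
        (fun θ hθ => (hF θ hθ).1) (abs_nonneg C) hβ hHolI hK hKs hpos h1 hw0 hfix hone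
        (by positivity) he) hθh
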